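/- Work on the Riemann sphere $\hat{\mathbb C}=\mathbb C\cup\{\infty\}$. A circline is a Euclidean circle or a straight line together with $\infty$; an arc between two distinct points $A,B$ of a circline $C$ is one of the two components of $C\setminus\{A,B\}$ together with $A$ and $B$; conformal maps are the Möbius transformations $z\mapsto\frac{az+b}{cz+d}$, $ad-bc\neq0$. A \emph{conformal bryophyllum} $(A_0,A_+,A_-,s_+,s_-,s_0,T_+,T_-)$ consists of three distinct points $A_0,A_+,A_-$; arcs $s_0$ between $A_+$ and $A_-$ and $s_\pm$ between $A_\pm$ and $A_0$, such that the circlines determined by $s_+$ and $s_-$ do not coincide and $s_+\cap s_-=\{A_0\}$; and conformal maps $T_\pm$ with $T_\pm(A_\pm)=A_0$, $T_\pm(A_\mp)=A_\pm$, $T_\pm(s_0)=s_\pm$, $T_\pm(A_0)\in s_0$, such that $T_+(s_-)$ and $T_-(s_+)$ are contained in the circline determined by $s_0$. A conformal bryophyllum is \emph{Farey} if: (i) (Edge Condition) its edges meet only in the vertices: $s_+\cap s_-=\{A_0\}$, $s_+\cap s_0=\{A_+\}$, $s_-\cap s_0=\{A_-\}$, and they bound a curvilinear triangle: there is exactly one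 connected component $\Delta^\circ$ of $\hat{\mathbb C}\setminus(s_+\cup s_-\cup s_0)$ that does not contain the intersection point other than $A_0$ of the circlines determined by $s_+$ and $s_-$; put $\Delta=\overline{\Delta^\circ}$; (ii) (Inclusion Condition) $T_\pm(\Delta^\circ)\subset\Delta^\circ$ and $T_\pm(\Delta)\subset\Delta$; (iii) (Separation Condition) $T_+(\Delta)\cap T_-(\Delta)=\{A_0\}$. Let $\varphi\in(0,\pi)$, $\psi\in[0,\pi]$, $\varphi+\psi\neq\pi$, and $r=\frac{\cos(\varphi/2+\psi)}{\cos(\varphi/2)}$. The \emph{canonical bryophyllum} $\mathrm{Br}_{\varphi,\psi}$ has vertices $A_0=1$, $A_\pm=e^{\pm i\varphi}$; edges $s_\pm=[A_\pm,A_0]$ (straight line segments) and $s_0$, which is the straight line segment $[A_+,A_-]$ if $\psi=\varphi/2$ and otherwise is the arc between $A_+$ and $A_-$ containing $re^{i\psi}$ of the circle through $A_+$, $A_-$, $re^{i\psi}$; and maps $$T_\pm(z)=\frac{(re^{\pm i\psi}-\cos(\varphi/2)e^{\pm i\varphi/2})z+(\cos(\varphi/2)e^{\pm i\varphi/2}-r\cos(\varphi)e^{\pm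 i\psi})}{(r\cos(\varphi/2)e^{\pm i(\psi-\varphi/2)}-\cos\varphi)z+(1-r\cos(\varphi/2)e^{\pm i(\psi-\varphi/2)})}.$$ \textbf{Theorem.} If $$\sin\psi+2\sin\left(\psi-\tfrac{\varphi}{2}\right)\cos\tfrac{\varphi}{2}\ge0,\qquad \sin\psi\cos\varphi-2\sin\left(\psi-\tfrac{\varphi}{2}\right)\cos\tfrac{\varphi}{2}\ge0,\qquad \varphi+2\psi<\pi,$$ then $\mathrm{Br}_{\varphi,\psi}$ is a conformal bryophyllum and it is Farey. -/

import Mathlib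

open scoped OnePoint

noncomputable section

/-- A circline on the Riemann sphere `OnePoint ℂ`: a Euclidean circle of positive radius, or a
straight line together with `∞`. -/
def IsCircline (C : Set (OnePoint ℂ)) : Prop :=
  (∃ (c : ℂ) (R : ℝ), 0 < R ∧ C = (fun z : ℂ => (z : OnePoint ℂ)) '' Metric.sphere c R) ∨
  (∃ a v : ℂ, v ≠ 0 ∧
    C = insert ∞ ((fun z : ℂ => (z : OnePoint ℂ)) '' {z : ℂ | ∃ t : ℝ, z = a + t * v}))

/-- `U` is a connected component of the set `K`. -/
def IsComponentOf (U K : Set (OnePoint ℂ)) : Prop :=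
  ∃ x ∈ K, U = connectedComponentIn K x

/-- `s` is an arc (or segment) between two distinct points `A` and `B`: one of the two connected
components of `C \ {A, B}`, for a circline `C` through `A` and `B`, together with its end points. -/
def IsArc (A B : OnePoint ℂ) (s : Set (OnePoint ℂ)) : Prop :=
  A ≠ B ∧ ∃ C U : Set (OnePoint ℂ), IsCircline C ∧ A ∈ C ∧ B ∈ C ∧
    IsComponentOf U (C \ {A, B}) ∧ s = {A, B} ∪ U

/-- A conformal automorphism of the Riemann sphere, i.e. a (holomorphic) Moebius
transformation. -/
def IsMoebiusMap (T : OnePoint ℂ → OnePoint ℂ) : Prop :=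
  ∃ g : GL (Fin 2) ℂ, ∀ z, T z = g • z

/-- The fractional linear map `z ↦ (a z + b) / (c z + d)` on the Riemann sphere. -/
def fracLin (a b c d : ℂ) : OnePoint ℂ → OnePoint ℂ
  | ∞ => if c = 0 then ∞ else ((a / c : ℂ) : OnePoint ℂ)
  | (z : ℂ) => if c * z + d = 0 then ∞ else (((a * z + b) / (c * z + d) : ℂ) : OnePoint ℂ)

/-- The data of a bryophyllum: three vertices, three edges and two maps. -/
structure BryophyllumData where
  /-- the vertex `A₀` -/
  A0 : OnePoint ℂ
  /-- the vertex `A₊` -/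
  Ap : OnePoint ℂ
  /-- the vertex `A₋` -/
  Am : OnePoint ℂ
  /-- the edge `s₊` -/
  sp : Set (OnePoint ℂ)
  /-- the edge `s₋` -/
  sm : Set (OnePoint ℂ)
  /-- the edge `s₀` -/
  s0 : Set (OnePoint ℂ)
  /-- the map `T₊` -/
  Tp : OnePoint ℂ → OnePoint ℂ
  /-- the map `T₋` -/
  Tm : OnePoint ℂ → OnePoint ℂ

namespace BryophyllumData

/-- The data form a conformal bryophyllum. -/
structure IsConformalBryophyllum (B : BryophyllumData) : Prop where
  ne_0p : B.A0 ≠ B.Ap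
  ne_0m : B.A0 ≠ B.Am
  ne_pm : B.Ap ≠ B.Am
  arc_0 : IsArc B.Ap B.Am B.s0
  arc_p : IsArc B.Ap B.A0 B.sp
  arc_m : IsArc B.Am B.A0 B.sm
  /-- the circlines determined by `s₊` and `s₋` do not coincide -/
  circlines_ne : ¬ ∃ C, IsCircline C ∧ B.sp ⊆ C ∧ B.sm ⊆ C
  inter_pm : B.sp ∩ B.sm = {B.A0}
  conf_p : IsMoebiusMap B.Tp
  conf_m : IsMoebiusMap B.Tm
  Tp_Ap : B.Tp B.Ap = B.A0
  Tp_Am : B.Tp B.Am = B.Ap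
  Tp_s0 : B.Tp '' B.s0 = B.sp
  Tm_Am : B.Tm B.Am = B.A0
  Tm_Ap : B.Tm B.Ap = B.Am
  Tm_s0 : B.Tm '' B.s0 = B.sm
  Tp_A0 : B.Tp B.A0 ∈ B.s0
  Tm_A0 : B.Tm B.A0 ∈ B.s0
  /-- `T₊(s₋)` lies on the circline determined by `s₀` -/
  Tp_sm : ∃ C, IsCircline C ∧ B.s0 ⊆ C ∧ B.Tp '' B.sm ⊆ C
  /-- `T₋(s₊)` lies on the circline determined by `s₀` -/
  Tm_sp : ∃ C, IsCircline C ∧ B.s0 ⊆ C ∧ B.Tm '' B.sp ⊆ C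

/-- Edge Condition: the edges intersect only in the vertices. -/
def EdgeCondition (B : BryophyllumData) : Prop :=
  B.sp ∩ B.sm = {B.A0} ∧ B.sp ∩ B.s0 = {B.Ap} ∧ B.sm ∩ B.s0 = {B.Am}

/-- `p` is the intersection point other than `A₀` of the circlines determined by `s₊`, `s₋`. -/
def IsOppositePoint (B : BryophyllumData) (p : OnePoint ℂ) : Prop :=
  p ≠ B.A0 ∧ ∃ Cp Cm : Set (OnePoint ℂ), IsCircline Cp ∧ IsCircline Cm ∧
    B.sp ⊆ Cp ∧ B.sm ⊆ Cm ∧ Cp ∩ Cm = {B.A0, p}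

/-- `D` is the open curvilinear triangle bounded by the edges: the one and only connected component
of the complement of `s₊ ∪ s₋ ∪ s₀` that does not contain the intersection point other than `A₀` of
the circlines determined by `s₊` and `s₋`. -/
def IsOpenTriangle (B : BryophyllumData) (D : Set (OnePoint ℂ)) : Prop :=
  ∃ p, B.IsOppositePoint p ∧
    ∀ U, (IsComponentOf U (B.sp ∪ B.sm ∪ B.s0)ᶜ ∧ p ∉ U) ↔ U = D

/-- A Farey bryophyllum. The inclusion condition is required for the open triangle `D` as well as
for the closed triangle `Δ = closure D`; the separation condition, which involves the vertex `A₀`,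
concerns the closed triangle. -/
def IsFarey (B : BryophyllumData) : Prop :=
  B.IsConformalBryophyllum ∧ B.EdgeCondition ∧
    ∃ D, B.IsOpenTriangle D ∧
      (B.Tp '' D ⊆ D ∧ B.Tm '' D ⊆ D) ∧
      (B.Tp '' closure D ⊆ closure D ∧ B.Tm '' closure D ⊆ closure D) ∧
      (B.Tp '' closure D) ∩ (B.Tm '' closure D) = {B.A0}

end BryophyllumData

/-- `r = cos (φ/2 + ψ) / cos (φ/2)`. -/
def bryoR (φ ψ : ℝ) : ℝ := Real.cos (φ / 2 + ψ) / Real.cos (φ / 2)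

/-- The unit complex number `e^{i t}`. -/
def eUnit (t : ℝ) : ℂ := Complex.exp (t * Complex.I)

/-- The edge `s₀` of `Br_{φ,ψ}`, as a subset of `ℂ`. If `ψ = φ/2`, it is the straight line segment
`[A₊, A₋]`. Otherwise it is the arc between `A₊` and `A₋` that contains `Q = r e^{iψ}` of the
circle through `A₊, A₋, Q`: the points of this circle lying (weakly) on the same side of the line
`A₊A₋` as `Q`. -/
def canonicalS0 (φ ψ : ℝ) : Set ℂ :=
  open Classical in
  if ψ = φ / 2 then segment ℝ (eUnit φ) (eUnit (-φ))
  else {z : ℂ | EuclideanGeometry.Cospherical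
        ({eUnit φ, eUnit (-φ), bryoR φ ψ * eUnit ψ, z} : Set ℂ) ∧
      (affineSpan ℝ ({eUnit φ, eUnit (-φ)} : Set ℂ)).WSameSide z (bryoR φ ψ * eUnit ψ)}

/-- The map `T₊` (for `ε = 1`) or `T₋` (for `ε = -1`) of `Br_{φ,ψ}`. -/
def canonicalT (φ ψ ε : ℝ) : OnePoint ℂ → OnePoint ℂ :=
  fracLin
    (bryoR φ ψ * eUnit (ε * ψ) - Real.cos (φ / 2) * eUnit (ε * (φ / 2)))
    (Real.cos (φ / 2) * eUnit (ε * (φ / 2)) - bryoR φ ψ * Real.cos φ * eUnit (ε * ψ))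
    (bryoR φ ψ * Real.cos (φ / 2) * eUnit (ε * (ψ - φ / 2)) - Real.cos φ)
    (1 - bryoR φ ψ * Real.cos (φ / 2) * eUnit (ε * (ψ - φ / 2)))

/-- The canonical bryophyllum `Br_{φ,ψ}`. -/
def canonicalBryophyllum (φ ψ : ℝ) : BryophyllumData where
  A0 := ((1 : ℂ) : OnePoint ℂ)
  Ap := (eUnit φ : OnePoint ℂ)
  Am := (eUnit (-φ) : OnePoint ℂ)
  sp := (fun z : ℂ => (z : OnePoint ℂ)) '' segment ℝ (eUnit φ) 1
  sm := (fun z : ℂ => (z : OnePoint ℂ)) '' segment ℝ (eUnit (-φ)) 1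
  s0 := (fun z : ℂ => (z : OnePoint ℂ)) '' canonicalS0 φ ψ
  Tp := canonicalT φ ψ 1
  Tm := canonicalT φ ψ (-1)

end

/-!
The coordinate `u = 2 / (1 - z)` moves the vertex `A₀ = 1` to infinity, where everything becomes
explicit. With `h = cot (φ / 2)` the other vertices are `a = 1 + i h` and its conjugate, the edges
`s₊` and `s₋` are the rays from these points away from the origin, and `T₊` is
`u ↦ q + 2 i h (q - a) / (u - a)`, where `q = t + i h (t - 2)` is the image of `A₀`
(`canonicalT_chart`). The hypotheses on `φ` and `ψ` turn into `2 < t` and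
`1 + 3 h² ≤ t (1 + h²) ≤ 1 + 5 h²` (`FareyParam`, `exists_fareyParam`). The map `T₋` arises from
`T₊` by the change of `h` into `-h`, under which the triangle is invariant, so that every statement
about the maps is needed for `T₊` only.

The edge `s₀` is the part in `Re u ≥ 1` of a circle `F = 0`, and the open triangle consists of the
points with `Re u > 1`, `|Im u| < |h| Re u` and `F > 0`. Pulling back these functions by `T₊` yields
identities that give the Inclusion Condition (`mapU_mem_openTri`): the line of `s₊` pulls back to
the circle `F = 0`, this circle pulls back to the line of `s₋`, and `Re u - 1` pulls back to a
positive combination of `F` and `Re u - 1`. Finally `h Im T₊(u) > 0` on the closed triangle, except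
at the pole `a` (`mapU_im_pos`). This replaces the remaining inequality of the sector, and it is
also the Separation Condition, as `T₋` takes the triangle to the other side of the real axis.

The upper bound on `t` makes the triangle invariant under dilations `u ↦ l u`, `l ≥ 1`. Hence its
complement is star-shaped about `u = 0`, which is the point `z = ∞` where the lines of `s₊` and
`s₋` meet again, and the triangle itself is connected, as dilations move every point into a convex
part of the sector. So the complement of the edges has these two components
(`isComponentOf_edges`). That `s₀` is an arc follows from `T₊(s₀) = s₊` and from the fact
that the edge `s₀` is the part of its circline in the unit disk of the `z`-plane.
-/

noncomputable section

/-! ### The curvilinear triangle in the chart at `A₀` -/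

/-- The parameters of a canonical Farey bryophyllum in the chart `u = 2 / (1 - z)`, where `A₀` is
at infinity. For `h = cot (φ / 2)` the points `A₊` and `A₋` become `1 + i h` and `1 - i h`, and
`T₊(A₀)` becomes `t + i h (t - 2)`; replacing `h` by `-h` interchanges the roles of the signs `+`
and `-`. The inequality `2 < t` is the hypothesis `φ + 2 ψ < π`, while `lower` and `upper` are the
two non-strict hypotheses on `φ` and `ψ`. -/
structure FareyParam (h t : ℝ) : Prop where
  ne : h ≠ 0
  two_lt : 2 < t
  lower : 1 + 3 * h ^ 2 ≤ t * (1 + h ^ 2)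
  upper : t * (1 + h ^ 2) ≤ 1 + 5 * h ^ 2

/-- The vertex `A₊` in the chart `u = 2 / (1 - z)`; `A₋` is `vertA (-h)`. -/
def vertA (h : ℝ) : ℂ := ⟨1, h⟩

/-- The image `T₊(A₀)` of the vertex at infinity in the chart `u = 2 / (1 - z)`. -/
def vertQ (h t : ℝ) : ℂ := ⟨t, h * (t - 2)⟩

/-- The constant coefficient of `circF`. -/
def circP (h t : ℝ) : ℝ := t + h ^ 2 * (t - 4)

/-- The equation of the circle through `vertA (± h)` and `vertQ (± h) t`, which carries the
edge `s₀` in the chart `u = 2 / (1 - z)`; it is positive outside the circle. -/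
def circF (h t : ℝ) (u : ℂ) : ℝ :=
  u.re ^ 2 + u.im ^ 2 - (1 + h ^ 2 + circP h t) * u.re + circP h t

/-- The open triangle in the chart `u = 2 / (1 - z)`: the unbounded part of the sector
`|Im u| < |h| Re u` cut off by the circle `circF = 0`. -/
def openTri (h t : ℝ) : Set ℂ :=
  {u | 1 < u.re ∧ u.im ^ 2 < h ^ 2 * u.re ^ 2 ∧ 0 < circF h t u}

/-- The closed triangle without its vertex at infinity. -/
def closedTri (h t : ℝ) : Set ℂ :=
  {u | 1 ≤ u.re ∧ u.im ^ 2 ≤ h ^ 2 * u.re ^ 2 ∧ 0 ≤ circF h t u}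

/-- The edge `s₀` in the chart `u = 2 / (1 - z)`. -/
def arc0 (h t : ℝ) : Set ℂ := {u | 1 ≤ u.re ∧ circF h t u = 0}

/-- The ray from `vertA h` to infinity: the edge `s₊` in the chart `u = 2 / (1 - z)`, without
its end point at infinity. -/
def ray (h : ℝ) : Set ℂ := {u | 1 ≤ u.re ∧ u.im = h * u.re}

/-- The map `T₊` (for `h > 0`) or `T₋` (for `h < 0`) in the chart `u = 2 / (1 - z)`, away from its
pole `vertA h`. -/
def mapU (h t : ℝ) (u : ℂ) : ℂ :=
  vertQ h t + 2 * Complex.I * h * (vertQ h t - vertA h) / (u - vertA h)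

theorem openTri_neg (h t : ℝ) : openTri (-h) t = openTri h t := by
  simp [openTri, circF, circP]

theorem closedTri_neg (h t : ℝ) : closedTri (-h) t = closedTri h t := by
  simp [closedTri, circF, circP]

theorem arc0_neg (h t : ℝ) : arc0 (-h) t = arc0 h t := by
  simp [arc0, circF, circP]

theorem FareyParam.neg {h t : ℝ} (H : FareyParam h t) : FareyParam (-h) t :=
  ⟨neg_ne_zero.2 H.ne, H.two_lt, by simpa using H.lower, by simpa using H.upper⟩

theorem circF_vertA (h t : ℝ) : circF h t (vertA h) = 0 := by
  simp only [circF, circP, vertA]; ring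

theorem circF_vertQ (h t : ℝ) : circF h t (vertQ h t) = 0 := by
  simp only [circF, circP, vertQ]; ring

/-! ### The Inclusion Condition in the chart -/

/-- The squared distance of `u` from the pole of `mapU`. -/
def poleSq (h : ℝ) (u : ℂ) : ℝ := (u.re - 1) ^ 2 + (u.im - h) ^ 2

theorem poleSq_pos {h : ℝ} {u : ℂ} (hu : u ≠ vertA h) : 0 < poleSq h u := by
  by_contra hn
  have h0 : (u.re - 1) ^ 2 + (u.im - h) ^ 2 ≤ 0 := not_lt.1 hn
  have h1 : u.re - 1 = 0 := by nlinarith [sq_nonneg (u.re - 1), sq_nonneg (u.im - h)]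
  have h2 : u.im - h = 0 := by nlinarith [sq_nonneg (u.re - 1), sq_nonneg (u.im - h)]
  exact hu (Complex.ext (by simp [vertA]; linarith) (by simp [vertA]; linarith))

theorem mapU_re {h t : ℝ} {u : ℂ} (hu : u ≠ vertA h) :
    (mapU h t u).re = t + 2 * h * ((t - 1) * (u.im - h) - h * (t - 3) * (u.re - 1)) /
      poleSq h u := by
  have h0 := (poleSq_pos hu).ne'
  simp only [poleSq] at h0
  simp [mapU, vertQ, vertA, Complex.div_re, Complex.normSq_apply, poleSq]
  rw [← sq, ← sq]
  field_simp
  ring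

theorem mapU_im {h t : ℝ} {u : ℂ} (hu : u ≠ vertA h) :
    (mapU h t u).im = h * (t - 2) + 2 * h * ((t - 1) * (u.re - 1) + h * (t - 3) * (u.im - h)) /
      poleSq h u := by
  have h0 := (poleSq_pos hu).ne'
  simp only [poleSq] at h0
  simp [mapU, vertQ, vertA, Complex.div_im, Complex.normSq_apply, poleSq]
  rw [← sq, ← sq]
  field_simp
  ring

/-- The map `T₊` pulls the line of `s₊` back to the circle of `s₀`. -/
theorem mapU_line {h t : ℝ} {u : ℂ} (hu : u ≠ vertA h) :
    poleSq h u * (h * (mapU h t u).re - (mapU h t u).im) = 2 * h * circF h t u := by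
  have h0 := (poleSq_pos hu).ne'
  rw [mapU_re hu, mapU_im hu]
  field_simp
  simp only [poleSq, circF, circP]; ring

/-- The map `T₊` pulls the circle of `s₀` back to the line of `s₋`. -/
theorem mapU_circF {h t : ℝ} {u : ℂ} (hu : u ≠ vertA h) :
    poleSq h u * circF h t (mapU h t u) =
      2 * h * ((t - 1) ^ 2 + h ^ 2 * (t - 3) ^ 2) * (h * u.re + u.im) := by
  have h0 := (poleSq_pos hu).ne'
  simp only [circF]
  rw [mapU_re hu, mapU_im hu]
  field_simp
  simp only [poleSq, circP]; ring

/-- The left side is a positive combination of two of the functions that define the triangle,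
which keeps the image to the right of the line `Re u = 1`. -/
theorem mapU_re_sub_one {h t : ℝ} {u : ℂ} (hu : u ≠ vertA h) :
    poleSq h u * ((mapU h t u).re - 1) =
      (t - 1) * circF h t u + ((t - 1) ^ 2 + h ^ 2 * (t - 3) ^ 2) * (u.re - 1) := by
  have h0 := (poleSq_pos hu).ne'
  rw [mapU_re hu]
  field_simp
  simp only [poleSq, circF, circP]; ring

theorem mapU_im_mul {h t : ℝ} {u : ℂ} (hu : u ≠ vertA h) :
    poleSq h u * (h * (mapU h t u).im) =
      h ^ 2 * ((t - 2) * poleSq h u +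
        2 * ((t - 1) * (u.re - 1) + h * (t - 3) * (u.im - h))) := by
  have h0 := (poleSq_pos hu).ne'
  rw [mapU_im hu]
  field_simp

/-- The closed triangle is mapped by `T₊` strictly to the side of `A₊` of the real axis, except
for the vertex `A₊`, which goes to `A₀`. -/
theorem mapU_im_pos {h t : ℝ} (H : FareyParam h t) {u : ℂ} (hu : u ≠ vertA h)
    (hm : u ∈ closedTri h t) : 0 < h * (mapU h t u).im := by
  obtain ⟨h1, h2, h3⟩ := hm
  have hP := poleSq_pos hu
  have ht := H.two_lt
  have hh : 0 < h ^ 2 := by have := H.ne; positivity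
  have hlow : 0 ≤ t - 1 + h ^ 2 * (t - 3) := by linarith [H.lower]
  refine pos_of_mul_pos_right ?_ hP.le
  rw [mapU_im_mul hu]
  refine mul_pos hh ?_
  have hPt : 0 < (t - 2) * poleSq h u := mul_pos (by linarith) hP
  rcases le_total t 3 with h3t | h3t
  · -- the points of the sector lie below the line of `s₊`, which matters as `t - 3 ≤ 0`
    have hL : h * u.im ≤ h ^ 2 * u.re := by
      refine (abs_le_of_sq_le_sq' ?_ (by nlinarith)).2
      nlinarith
    nlinarith [mul_nonneg hlow (sub_nonneg.2 h1),
      mul_nonneg (sub_nonneg.2 h3t) (sub_nonneg.2 hL)]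
  · -- beyond the pole, away from the real axis, all terms are nonnegative; for the other points
    -- `circF ≥ 0` replaces `poleSq` by a linear function that is nonnegative there
    rcases le_total 0 (h * (u.im - h)) with hy | hy
    · nlinarith [mul_nonneg (sub_nonneg.2 h3t) hy, mul_nonneg (by linarith : 0 ≤ t - 1)
        (sub_nonneg.2 h1)]
    · have key : (t - 2) * poleSq h u + 2 * ((t - 1) * (u.re - 1) + h * (t - 3) * (u.im - h)) =
          (t - 2) * circF h t u +
            (((t - 2) * (t - 1 + h ^ 2 * (t - 3)) + 2 * (t - 1)) * (u.re - 1) +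
              2 * -(h * (u.im - h))) := by
        simp only [poleSq, circF, circP]; ring
      rw [key]
      have hX : 0 < (t - 2) * (t - 1 + h ^ 2 * (t - 3)) + 2 * (t - 1) := by
        have := mul_nonneg (by linarith : 0 ≤ t - 2) hlow
        linarith
      refine add_pos_of_nonneg_of_pos (mul_nonneg (by linarith) h3) ?_
      rcases h1.lt_or_eq with h1 | h1
      · have := mul_pos hX (sub_pos.2 h1)
        linarith
      · have hne : u.im - h ≠ 0 := fun h0 => hu
          (Complex.ext (by simp [vertA, ← h1]) (by simp [vertA]; linarith))
        have : h * (u.im - h) ≠ 0 := mul_ne_zero H.ne hne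
        have : h * (u.im - h) < 0 := lt_of_le_of_ne hy this
        rw [← h1]; linarith

/-- The squared distance of `vertQ h t` from `vertA h` is positive. -/
theorem sq_dist_pos {h t : ℝ} (H : FareyParam h t) :
    0 < (t - 1) ^ 2 + h ^ 2 * (t - 3) ^ 2 := by
  have : 0 < t - 1 := by linarith [H.two_lt]
  positivity

theorem ne_of_mem_openTri {h t : ℝ} {u : ℂ} (hm : u ∈ openTri h t) : u ≠ vertA h := by
  rintro rfl
  exact absurd hm.1 (by simp [vertA])

theorem openTri_subset_closedTri (h t : ℝ) : openTri h t ⊆ closedTri h t :=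
  fun _ hu => ⟨hu.1.le, hu.2.1.le, hu.2.2.le⟩

theorem mul_im_lt {h : ℝ} {u : ℂ} (h1 : 0 < u.re) (hh : 0 < h ^ 2)
    (h2 : u.im ^ 2 < h ^ 2 * u.re ^ 2) : |h * u.im| < h ^ 2 * u.re := by
  refine abs_lt_of_sq_lt_sq ?_ (by positivity)
  nlinarith

/-- The Inclusion Condition in the chart `u = 2 / (1 - z)`. -/
theorem mapU_mem_openTri {h t : ℝ} (H : FareyParam h t) {u : ℂ} (hm : u ∈ openTri h t) :
    mapU h t u ∈ openTri h t := by
  have hu := ne_of_mem_openTri hm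
  have hP := poleSq_pos hu
  have hh : 0 < h ^ 2 := by have := H.ne; positivity
  have hd := sq_dist_pos H
  have him := mapU_im_pos H hu (openTri_subset_closedTri h t hm)
  obtain ⟨h1, h2, h3⟩ := hm
  have hre : 1 < (mapU h t u).re := by
    have := mapU_re_sub_one (t := t) hu
    have h4 : 0 < poleSq h u * ((mapU h t u).re - 1) := by
      rw [this]
      exact add_pos (mul_pos (by linarith [H.two_lt]) h3) (mul_pos hd (by linarith))
    linarith [pos_of_mul_pos_right h4 hP.le]
  refine ⟨hre, ?_, ?_⟩
  · have h4 : 0 < poleSq h u * (h * (h * (mapU h t u).re - (mapU h t u).im)) := by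
      have := mapU_line (t := t) hu
      rw [mul_left_comm, this]
      nlinarith [mul_pos hh h3]
    have h5 := pos_of_mul_pos_right h4 hP.le
    have h6 : (h * (mapU h t u).im) ^ 2 < (h ^ 2 * (mapU h t u).re) ^ 2 := by
      refine sq_lt_sq' ?_ (by linarith)
      have : 0 < h ^ 2 * (mapU h t u).re := by positivity
      linarith
    have h7 : 0 < h ^ 2 * (h ^ 2 * (mapU h t u).re ^ 2 - (mapU h t u).im ^ 2) := by
      linarith
    linarith [pos_of_mul_pos_right h7 hh.le]
  · have h4 : 0 < poleSq h u * circF h t (mapU h t u) := by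
      rw [mapU_circF hu]
      have := (abs_lt.1 (mul_im_lt (by linarith) hh h2)).1
      have h5 : 0 < h ^ 2 * u.re + h * u.im := by linarith
      nlinarith [mul_pos hd h5]
    exact pos_of_mul_pos_right h4 hP.le

/-- The preimage of the edge `s₊` under `T₊` is the edge `s₀`. -/
theorem mapU_arc0 {h t : ℝ} (H : FareyParam h t) {u : ℂ} (hu : u ≠ vertA h) :
    mapU h t u ∈ ray h ↔ u ∈ arc0 h t := by
  have hP := poleSq_pos hu
  have h1 := mapU_line (t := t) hu
  have h2 := mapU_re_sub_one (t := t) hu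
  have hd := sq_dist_pos H
  constructor
  · rintro ⟨ha, hb⟩
    have hF : circF h t u = 0 := by
      rw [hb, sub_self, mul_zero] at h1
      have h0 : 2 * h ≠ 0 := mul_ne_zero two_ne_zero H.ne
      exact (mul_eq_zero.1 h1.symm).resolve_left h0
    refine ⟨?_, hF⟩
    rw [hF, mul_zero, zero_add] at h2
    have := mul_nonneg hP.le (sub_nonneg.2 ha)
    rw [h2] at this
    linarith [nonneg_of_mul_nonneg_right this hd]
  · rintro ⟨ha, hF⟩
    rw [hF, mul_zero, zero_add] at h2
    rw [hF, mul_zero] at h1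
    refine ⟨?_, ?_⟩
    · have := mul_nonneg hd.le (sub_nonneg.2 ha)
      rw [← h2] at this
      linarith [nonneg_of_mul_nonneg_right this hP]
    · linarith [(mul_eq_zero.1 h1).resolve_left hP.ne']

/-! ### The edges and the two components -/

theorem circP_le {h t : ℝ} (H : FareyParam h t) : circP h t ≤ 1 + h ^ 2 := by
  simp only [circP]; linarith [H.upper]

/-- The coefficient of `Re u` in `circF` is bounded below by the hypothesis `lower`. -/
theorem two_le_lin {h t : ℝ} (H : FareyParam h t) : 2 ≤ 1 + h ^ 2 + circP h t := by
  simp only [circP]; linarith [H.lower]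

/-- On the circle of `s₀` the equation of the two lines of `s₊` and `s₋` factors, with a second
factor that is nonnegative for `1 ≤ Re u` by the hypothesis `upper`. -/
theorem sector_sub {h t : ℝ} (u : ℂ) : h ^ 2 * u.re ^ 2 - u.im ^ 2 =
    (u.re - 1) * ((1 + h ^ 2) * u.re - circP h t) - circF h t u := by
  simp only [circF, circP]; ring

theorem arc0_subset_closedTri {h t : ℝ} (H : FareyParam h t) : arc0 h t ⊆ closedTri h t := by
  rintro u ⟨h1, h2⟩
  refine ⟨h1, ?_, h2.ge⟩
  have := sector_sub (h := h) (t := t) u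
  rw [h2, sub_zero] at this
  have h3 : 0 ≤ (1 + h ^ 2) * u.re - circP h t := by nlinarith [circP_le H, sq_nonneg h]
  nlinarith [mul_nonneg (sub_nonneg.2 h1) h3]

theorem ray_subset_closedTri {h t : ℝ} (H : FareyParam h t) : ray h ⊆ closedTri h t := by
  rintro u ⟨h1, h2⟩
  refine ⟨h1, by rw [h2]; nlinarith, ?_⟩
  have := sector_sub (h := h) (t := t) u
  rw [h2] at this
  have h3 : 0 ≤ (1 + h ^ 2) * u.re - circP h t := by nlinarith [circP_le H, sq_nonneg h]
  nlinarith [mul_nonneg (sub_nonneg.2 h1) h3]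

/-- The Edge Condition in the chart `u = 2 / (1 - z)`. -/
theorem ray_inter_arc0 {h t : ℝ} (H : FareyParam h t) : ray h ∩ arc0 h t = {vertA h} := by
  ext u
  constructor
  · rintro ⟨⟨h1, h2⟩, -, h3⟩
    have := sector_sub (h := h) (t := t) u
    rw [h2, h3, sub_zero, mul_pow, sub_self] at this
    have h5 : u.re = 1 := by
      rcases mul_eq_zero.1 this.symm with h4 | h4
      · linarith
      · nlinarith [circP_le H, sq_nonneg h]
    exact Complex.ext (by simp [vertA, h5]) (by simp [vertA, h5, h2])
  · rintro rfl
    exact ⟨⟨by simp [vertA], by simp [vertA]⟩, by simp [vertA], circF_vertA h t⟩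

theorem closedTri_eq {h t : ℝ} (H : FareyParam h t) :
    closedTri h t = openTri h t ∪ (ray h ∪ ray (-h) ∪ arc0 h t) := by
  apply Set.Subset.antisymm
  · rintro u ⟨h1, h2, h3⟩
    by_cases hF : circF h t u = 0
    · exact Or.inr (Or.inr ⟨h1, hF⟩)
    by_cases hy : u.im ^ 2 = h ^ 2 * u.re ^ 2
    · right; left
      rw [← mul_pow] at hy
      rcases sq_eq_sq_iff_eq_or_eq_neg.1 hy with h4 | h4
      · exact Or.inl ⟨h1, h4⟩
      · exact Or.inr ⟨h1, by rw [h4]; ring⟩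
    · left
      refine ⟨lt_of_le_of_ne h1 ?_, lt_of_le_of_ne h2 hy, lt_of_le_of_ne h3 (Ne.symm hF)⟩
      intro h4
      -- on the line `Re u = 1` the sector and the outside of the circle meet in vertices only
      have := sector_sub (h := h) (t := t) u
      rw [← h4] at this h2 hy
      exact hF (by nlinarith)
  · rintro u (hu | (hu | hu) | hu)
    · exact openTri_subset_closedTri h t hu
    · exact ray_subset_closedTri H hu
    · rw [← closedTri_neg]; exact ray_subset_closedTri H.neg hu
    · exact arc0_subset_closedTri H hu

theorem openTri_disjoint {h t : ℝ} : Disjoint (openTri h t) (ray h ∪ ray (-h) ∪ arc0 h t) := by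
  rw [Set.disjoint_left]
  rintro u ⟨h1, h2, h3⟩ ((⟨-, h4⟩ | ⟨-, h4⟩) | ⟨-, h4⟩)
  · rw [h4] at h2; nlinarith
  · rw [h4] at h2; nlinarith
  · exact h3.ne' h4

/-- The function `circF` increases along rays from the origin in the triangle. Hence the triangle
is stable under dilations. -/
theorem smul_circF {h t : ℝ} (H : FareyParam h t) {u : ℂ} (hu : u ∈ closedTri h t) {l : ℝ}
    (hl : 1 ≤ l) : circF h t u ≤ circF h t (l * u) := by
  obtain ⟨h1, h2, h3⟩ := hu
  have h4 : circF h t (l * u) - l * circF h t u =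
      (l - 1) * (l * (u.re ^ 2 + u.im ^ 2) - circP h t) := by
    simp [circF]; ring
  have h5 : 1 + h ^ 2 ≤ u.re ^ 2 + u.im ^ 2 := by
    have h6 : circF h t u = u.re ^ 2 + u.im ^ 2 - (1 + h ^ 2) -
      (1 + h ^ 2 + circP h t) * (u.re - 1) := by simp only [circF]; ring
    nlinarith [two_le_lin H]
  have h6 : 0 ≤ l * (u.re ^ 2 + u.im ^ 2) - circP h t := by nlinarith [circP_le H, sq_nonneg h]
  nlinarith [mul_nonneg (sub_nonneg.2 hl) h6, mul_nonneg (sub_nonneg.2 hl) h3]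

theorem smul_mem_openTri {h t : ℝ} (H : FareyParam h t) {u : ℂ} (hu : u ∈ openTri h t) {l : ℝ}
    (hl : 1 ≤ l) : (l : ℂ) * u ∈ openTri h t := by
  have h4 := smul_circF H (openTri_subset_closedTri h t hu) hl
  obtain ⟨h1, h2, h3⟩ := hu
  refine ⟨by simp; nlinarith, ?_, h3.trans_le h4⟩
  have : 0 < l ^ 2 := by positivity
  simp only [Complex.mul_re, Complex.ofReal_re, Complex.ofReal_im, zero_mul, sub_zero,
    Complex.mul_im, add_zero, mul_pow]
  nlinarith

theorem smul_mem_closedTri {h t : ℝ} (H : FareyParam h t) {u : ℂ} (hu : u ∈ closedTri h t)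
    {l : ℝ} (hl : 1 ≤ l) : (l : ℂ) * u ∈ closedTri h t := by
  have h4 := smul_circF H hu hl
  obtain ⟨h1, h2, h3⟩ := hu
  refine ⟨by simp; nlinarith, ?_, h3.trans h4⟩
  have : 0 < l ^ 2 := by positivity
  simp only [Complex.mul_re, Complex.ofReal_re, Complex.ofReal_im, zero_mul, sub_zero,
    Complex.mul_im, add_zero, mul_pow]
  nlinarith

/-- The complement of the closed triangle is star-shaped with respect to `0`, the image of `∞`. -/
theorem isPreconnected_compl_closedTri {h t : ℝ} (H : FareyParam h t) :
    IsPreconnected (closedTri h t)ᶜ := by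
  have h0 : (0 : ℂ) ∈ (closedTri h t)ᶜ := by
    intro h0
    have := h0.1
    simp only [Complex.zero_re] at this
    linarith
  have hs : StarConvex ℝ (0 : ℂ) (closedTri h t)ᶜ := by
    intro u hu a b ha hb hab hm
    simp only [smul_zero, zero_add, Complex.real_smul] at hm
    have hb0 : b ≠ 0 := by
      rintro rfl
      simp only [Complex.ofReal_zero, zero_mul] at hm
      exact h0 hm
    have hb' : 0 < b := lt_of_le_of_ne hb hb0.symm
    have := smul_mem_closedTri H hm (l := b⁻¹) ((one_le_inv₀ hb').2 (by linarith))
    rw [← mul_assoc, ← Complex.ofReal_mul, inv_mul_cancel₀ hb0] at this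
    exact hu (by simpa using this)
  exact (hs.isPathConnected h0).isConnected.isPreconnected

theorem nonempty_openTri {h t : ℝ} (H : FareyParam h t) : (openTri h t).Nonempty := by
  refine ⟨((2 + |1 + h ^ 2 + circP h t| + |circP h t| : ℝ) : ℂ), ?_⟩
  have hh : 0 < h ^ 2 := by have := H.ne; positivity
  set x := 2 + |1 + h ^ 2 + circP h t| + |circP h t|
  have h1 : 1 < x := by
    have := abs_nonneg (1 + h ^ 2 + circP h t); have := abs_nonneg (circP h t)
    simp only [x]; linarith
  refine ⟨by simpa using h1, ?_, ?_⟩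
  · have h2 : 0 < x := by linarith
    simp only [Complex.ofReal_re, Complex.ofReal_im, zero_pow two_ne_zero]
    positivity
  · simp only [circF, Complex.ofReal_re, Complex.ofReal_im]
    have h2 : 1 + h ^ 2 + circP h t ≤ x - |circP h t| - 1 := by
      have := le_abs_self (1 + h ^ 2 + circP h t); simp only [x]; linarith
    have h3 := neg_abs_le (circP h t)
    have h4 := abs_nonneg (circP h t)
    nlinarith

/-- Far to the right the triangle coincides with the sector, which is convex, and every point of
the triangle can be moved there by a dilation. -/
theorem isPreconnected_openTri {h t : ℝ} (H : FareyParam h t) :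
    IsPreconnected (openTri h t) := by
  have hh : 0 < h ^ 2 := by have := H.ne; positivity
  -- so large that `circF` is positive wherever `M ≤ Re u`
  set M := 2 + |1 + h ^ 2 + circP h t| + |circP h t| with hM
  have hM1 : 1 < M := by
    have := abs_nonneg (1 + h ^ 2 + circP h t); have := abs_nonneg (circP h t)
    simp only [M]; linarith
  set W : Set ℂ := {u | M ≤ u.re ∧ |u.im| < |h| * u.re} with hW
  have hWc : Convex ℝ W := by
    rintro x ⟨hx1, hx2⟩ y ⟨hy1, hy2⟩ a b ha hb hab
    obtain ⟨hx2, hx3⟩ := abs_lt.1 hx2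
    obtain ⟨hy2, hy3⟩ := abs_lt.1 hy2
    refine ⟨?_, abs_lt.2 ⟨?_, ?_⟩⟩
    · simp only [Complex.add_re, Complex.real_smul, Complex.mul_re, Complex.ofReal_re,
        Complex.ofReal_im, zero_mul, sub_zero]
      nlinarith
    all_goals
      simp only [Complex.add_re, Complex.add_im, Complex.real_smul, Complex.mul_re,
        Complex.mul_im, Complex.ofReal_re, Complex.ofReal_im, zero_mul, sub_zero, add_zero]
      rcases ha.lt_or_eq with ha | ha
      · nlinarith [mul_pos ha (sub_pos.2 hx2), mul_pos ha (sub_pos.2 hx3),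
          mul_nonneg hb (sub_pos.2 hy2).le, mul_nonneg hb (sub_pos.2 hy3).le]
      · obtain rfl : b = 1 := by linarith
        rw [← ha]; linarith
  have hWs : W ⊆ openTri h t := by
    rintro u ⟨h1, h2⟩
    refine ⟨by linarith, ?_, ?_⟩
    · have := sq_lt_sq' (by linarith [abs_nonneg u.im]) h2
      rwa [sq_abs, mul_pow, sq_abs] at this
    · simp only [circF]
      have h2 : 1 + h ^ 2 + circP h t ≤ u.re - |circP h t| - 1 := by
        have := le_abs_self (1 + h ^ 2 + circP h t); linarith
      have h3 := neg_abs_le (circP h t)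
      have h4 := abs_nonneg (circP h t)
      nlinarith [sq_nonneg u.im]
  have hMW : (M : ℂ) ∈ W := by
    have := abs_pos.2 H.ne
    refine ⟨by simp, ?_⟩
    simp only [Complex.ofReal_im, abs_zero, Complex.ofReal_re]; positivity
  refine isPreconnected_of_forall (M : ℂ) fun u hu => ?_
  set S : Set ℂ := (fun l : ℝ => (l : ℂ) * u) '' Set.Ici 1 with hS
  have hSc : IsPreconnected S :=
    isPreconnected_Ici.image _ (by fun_prop)
  have hSs : S ⊆ openTri h t := by
    rintro _ ⟨l, hl, rfl⟩
    exact smul_mem_openTri H hu hl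
  refine ⟨S ∪ W, Set.union_subset hSs hWs, Or.inr hMW, Or.inl ⟨1, by simp, by simp⟩, ?_⟩
  refine hSc.union' ⟨(M : ℂ) * u, ⟨M, hM1.le, rfl⟩, ?_⟩ hWc.isPreconnected
  obtain ⟨h1, h2, -⟩ := smul_mem_openTri H hu hM1.le
  refine ⟨?_, ?_⟩
  · simp only [Complex.mul_re, Complex.ofReal_re, Complex.ofReal_im, zero_mul, sub_zero]
    nlinarith [hu.1]
  · refine abs_lt_of_sq_lt_sq ?_ (by positivity)
    rwa [mul_pow, sq_abs]

theorem isOpen_openTri (h t : ℝ) : IsOpen (openTri h t) := by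
  have hc : Continuous (circF h t) := by unfold circF; fun_prop
  have h2 : IsOpen {u : ℂ | u.im ^ 2 < h ^ 2 * u.re ^ 2} :=
    isOpen_lt (by fun_prop) (by fun_prop)
  exact (isOpen_lt continuous_const Complex.continuous_re).inter
    (h2.inter (isOpen_lt continuous_const hc))

theorem isClosed_closedTri (h t : ℝ) : IsClosed (closedTri h t) := by
  have hc : Continuous (circF h t) := by unfold circF; fun_prop
  have h2 : IsClosed {u : ℂ | u.im ^ 2 ≤ h ^ 2 * u.re ^ 2} :=
    isClosed_le (by fun_prop) (by fun_prop)
  exact (isClosed_le continuous_const Complex.continuous_re).inter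
    (h2.inter (isClosed_le continuous_const hc))

/-- The vertex `A₊` is a limit of points of the open triangle. -/
theorem vertA_mem_closure {h t : ℝ} (H : FareyParam h t) : vertA h ∈ closure (openTri h t) := by
  have hh : 0 < h ^ 2 := by have := H.ne; positivity
  -- a curve in the triangle that is tangent to the edge `s₊` at the vertex
  let c : ℝ → ℂ := fun s => ⟨1 + s, h + s * (h - s / (4 * h))⟩
  have hc : Filter.Tendsto c (nhdsWithin 0 (Set.Ioi 0)) (nhds (vertA h)) := by
    have h1 : Continuous c := Complex.equivRealProdCLM.symm.continuous.comp
      (by fun_prop : Continuous fun s : ℝ => (1 + s, h + s * (h - s / (4 * h))))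
    have h2 := (h1.tendsto 0).mono_left (nhdsWithin_le_nhds (s := Set.Ioi 0))
    have h3 : c 0 = vertA h := by simp [c, vertA]
    rwa [h3] at h2
  refine mem_closure_of_tendsto hc ?_
  have h8 : (0 : ℝ) < min 1 (4 * h ^ 2) := by positivity
  filter_upwards [Ioo_mem_nhdsGT h8] with s hs
  obtain ⟨h0, h1⟩ := hs
  have h2 := h1.trans_le (min_le_left _ _)
  have h3 := h1.trans_le (min_le_right _ _)
  have hne := H.ne
  refine ⟨by simp [c, h0], ?_, ?_⟩
  · have e : h ^ 2 * (1 + s) ^ 2 - (h + s * (h - s / (4 * h))) ^ 2 =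
        s ^ 2 / 4 * (2 * (1 + s) - s ^ 2 / (4 * h ^ 2)) := by
      field_simp; ring
    have h5 : s ^ 2 / (4 * h ^ 2) ≤ s := by
      rw [div_le_iff₀ (by positivity)]; nlinarith
    have h6 : 0 < s ^ 2 / 4 * (2 * (1 + s) - s ^ 2 / (4 * h ^ 2)) :=
      mul_pos (by positivity) (by linarith)
    simp only [c]; linarith
  · have e : circF h t (c s) = s ^ 2 * (1 / 2 + (h - s / (4 * h)) ^ 2) +
        s * (1 + h ^ 2 - circP h t) := by
      simp only [circF, c, circP]; field_simp; ring
    rw [e]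
    exact add_pos_of_pos_of_nonneg (by positivity)
      (mul_nonneg h0.le (by linarith [circP_le H]))

/-! ### Moebius maps of the Riemann sphere -/

section Moebius

open Filter Topology

theorem fracLin_infty (a b c d : ℂ) :
    fracLin a b c d ∞ = if c = 0 then ∞ else ((a / c : ℂ) : OnePoint ℂ) := rfl

theorem fracLin_coe (a b c d z : ℂ) :
    fracLin a b c d (z : OnePoint ℂ) =
      if c * z + d = 0 then ∞ else (((a * z + b) / (c * z + d) : ℂ) : OnePoint ℂ) := rfl

theorem smul_eq_fracLin (g : GL (Fin 2) ℂ) (z : OnePoint ℂ) :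
    g • z = fracLin (g 0 0) (g 0 1) (g 1 0) (g 1 1) z := by
  induction z using OnePoint.rec with
  | infty => rw [OnePoint.smul_infty_eq_ite, fracLin_infty]
  | coe z => rw [OnePoint.smul_some_eq_ite, fracLin_coe]

/-- The element of `GL₂` with the given entries. -/
def glMk (a b c d : ℂ) (h : a * d - b * c ≠ 0) : GL (Fin 2) ℂ :=
  Matrix.GeneralLinearGroup.mkOfDetNeZero !![a, b; c, d] (by rwa [Matrix.det_fin_two_of])

theorem glMk_smul {a b c d : ℂ} (h : a * d - b * c ≠ 0) (z : OnePoint ℂ) :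
    glMk a b c d h • z = fracLin a b c d z := by
  rw [smul_eq_fracLin]; rfl

theorem fracLin_comp {a b c d a' b' c' d' : ℂ} (h : a * d - b * c ≠ 0)
    (h' : a' * d' - b' * c' ≠ 0) (z : OnePoint ℂ) :
    fracLin a b c d (fracLin a' b' c' d' z) =
      fracLin (a * a' + b * c') (a * b' + b * d') (c * a' + d * c') (c * b' + d * d') z := by
  rw [← glMk_smul h, ← glMk_smul h', ← mul_smul, smul_eq_fracLin]
  simp [glMk, Matrix.GeneralLinearGroup.mkOfDetNeZero, Matrix.mul_apply, Fin.sum_univ_two]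

theorem fracLin_scale {a b c d k : ℂ} (hk : k ≠ 0) (z : OnePoint ℂ) :
    fracLin (k * a) (k * b) (k * c) (k * d) z = fracLin a b c d z := by
  induction z using OnePoint.rec with
  | infty => simp only [fracLin_infty, mul_eq_zero, hk, false_or, mul_div_mul_left _ _ hk]
  | coe z =>
    simp only [fracLin_coe, mul_assoc, ← mul_add, mul_eq_zero, hk, false_or,
      mul_div_mul_left _ _ hk]

theorem continuous_fracLin_inv : Continuous (fracLin 0 1 1 0) := by
  rw [OnePoint.continuous_iff]
  constructor
  · rw [coclosedCompact_eq_cocompact, ← Metric.cobounded_eq_cocompact]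
    have h1 : Tendsto (fun z : ℂ => ((z⁻¹ : ℂ) : OnePoint ℂ)) (Bornology.cobounded ℂ)
        (𝓝 ((0 : ℂ) : OnePoint ℂ)) :=
      (OnePoint.continuous_coe.tendsto 0).comp tendsto_inv₀_cobounded
    rw [show fracLin 0 1 1 0 ∞ = ((0 : ℂ) : OnePoint ℂ) by simp [fracLin_infty]]
    refine h1.congr' ?_
    filter_upwards [Bornology.eventually_ne_cobounded (0 : ℂ)] with z hz
    simp [fracLin_coe, hz]
  · rw [continuous_iff_continuousAt]
    intro z
    by_cases hz : z = 0
    · subst hz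
      rw [ContinuousAt, ← nhdsNE_sup_pure, tendsto_sup]
      have h0 : fracLin 0 1 1 0 ((0 : ℂ) : OnePoint ℂ) = ∞ := by simp [fracLin_coe]
      refine ⟨?_, ?_⟩
      · have h1 : Tendsto (fun z : ℂ => ((z⁻¹ : ℂ) : OnePoint ℂ)) (𝓝[≠] (0 : ℂ))
            (𝓝 (∞ : OnePoint ℂ)) := by
          refine OnePoint.tendsto_coe_infty.comp ?_
          rw [coclosedCompact_eq_cocompact, ← Metric.cobounded_eq_cocompact]
          exact tendsto_inv₀_nhdsNE_zero
        rw [h0]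
        refine h1.congr' ?_
        filter_upwards [self_mem_nhdsWithin] with z hz
        have hz : z ≠ 0 := hz
        simp [fracLin_coe, hz]
      · exact tendsto_pure_nhds _ _
    · have h1 : ContinuousAt (fun z : ℂ => ((z⁻¹ : ℂ) : OnePoint ℂ)) z :=
        OnePoint.continuous_coe.continuousAt.comp (continuousAt_inv₀ hz)
      refine h1.congr ?_
      filter_upwards [isOpen_ne.mem_nhds hz] with w hw
      have hw : w ≠ 0 := hw
      simp [fracLin_coe, hw]

theorem continuous_fracLin_affine {a : ℂ} (ha : a ≠ 0) (b : ℂ) :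
    Continuous (fracLin a b 0 1) := by
  have h1 : fracLin a b 0 1 = OnePoint.map (fun z => a * z + b) := by
    funext z
    induction z using OnePoint.rec with
    | infty => simp [fracLin_infty]
    | coe z => simp [fracLin_coe]
  rw [h1]
  refine OnePoint.continuous_map (by fun_prop) ?_
  have h2 := ((Homeomorph.mulLeft₀ a ha).trans (Homeomorph.addRight b)).isClosedEmbedding
  rw [coclosedCompact_eq_cocompact]
  exact h2.tendsto_cocompact

theorem continuous_fracLin {a b c d : ℂ} (h : a * d - b * c ≠ 0) :
    Continuous (fracLin a b c d) := by
  by_cases hc : c = 0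
  · subst hc
    have hd : d ≠ 0 := by rintro rfl; simp at h
    have ha : a ≠ 0 := by rintro rfl; simp at h
    have h1 : fracLin a b 0 d = fracLin (a / d) (b / d) 0 1 := by
      funext z
      rw [← fracLin_scale hd (a := a / d), mul_div_cancel₀ _ hd, mul_div_cancel₀ _ hd, mul_zero,
        mul_one]
    rw [h1]
    exact continuous_fracLin_affine (div_ne_zero ha hd) _
  · have h1 : fracLin a b c d = fracLin (-(a * d - b * c) / c) (a / c) 0 1 ∘
        fracLin 0 1 1 0 ∘ fracLin c d 0 1 := by
      funext z
      have h2 : -(a * d - b * c) / c ≠ 0 := div_ne_zero (neg_ne_zero.2 h) hc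
      simp only [Function.comp]
      rw [fracLin_comp ?_ (by simp), fracLin_comp ?_ (by simpa using hc)]
      rotate_left
      · simpa only [mul_zero, zero_mul, add_zero, zero_add, mul_one, zero_sub] using
          neg_ne_zero.2 h2
      · simpa only [mul_zero, mul_one, sub_zero] using h2
      congr 1 <;> field_simp <;> ring
    rw [h1]
    exact (continuous_fracLin_affine (div_ne_zero (neg_ne_zero.2 h) hc) _).comp
      (continuous_fracLin_inv.comp (continuous_fracLin_affine hc d))

instance : ContinuousConstSMul (GL (Fin 2) ℂ) (OnePoint ℂ) where
  continuous_const_smul g := by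
    have h : g 0 0 * g 1 1 - g 0 1 * g 1 0 ≠ 0 := by
      rw [← Matrix.det_fin_two]; exact g.det_ne_zero
    rw [show (fun z : OnePoint ℂ => g • z) = fracLin (g 0 0) (g 0 1) (g 1 0) (g 1 1) from
      funext (smul_eq_fracLin g)]
    exact continuous_fracLin h

end Moebius

/-! ### Components and arcs -/

/-- A preconnected subset that is relatively clopen is a connected component. -/
theorem connectedComponentIn_eq_of_clopen {X : Type*} [TopologicalSpace X] {U K O Z : Set X}
    (hO : IsOpen O) (hZ : IsClosed Z) (hKO : K ∩ O = U) (hKZ : K ∩ Z = U)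
    (hU : IsPreconnected U) {x : X} (hx : x ∈ U) : connectedComponentIn K x = U := by
  have hUK : U ⊆ K := hKO ▸ Set.inter_subset_left
  apply Set.Subset.antisymm
  · have hCK := connectedComponentIn_subset K x
    intro y hy
    by_contra hyU
    have hyZ : y ∉ Z := fun h => hyU (hKZ ▸ ⟨hCK hy, h⟩)
    have hcov : connectedComponentIn K x ⊆ O ∪ Zᶜ := by
      intro w hw
      by_cases hwZ : w ∈ Z
      · have : w ∈ K ∩ O := by rw [hKO, ← hKZ]; exact ⟨hCK hw, hwZ⟩
        exact Or.inl this.2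
      · exact Or.inr hwZ
    have hxO : x ∈ K ∩ O := hKO.symm ▸ hx
    obtain ⟨w, hw, hwO, hwZ⟩ := isPreconnected_connectedComponentIn (F := K) (x := x) O Zᶜ hO
      hZ.isOpen_compl hcov ⟨x, mem_connectedComponentIn hxO.1, hxO.2⟩ ⟨y, hy, hyZ⟩
    have : w ∈ K ∩ Z := by rw [hKZ, ← hKO]; exact ⟨hCK hw, hwO⟩
    exact hwZ this.2
  · exact hU.subset_connectedComponentIn hx hUK

/-- A closed subset of a circline that contains its end points and is, away from them, connected
and open in the circline is an arc. -/
theorem isArc_of_isOpen {A B : OnePoint ℂ} {s C O : Set (OnePoint ℂ)} (hAB : A ≠ B)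
    (hC : IsCircline C) (hsC : s ⊆ C) (hA : A ∈ s) (hB : B ∈ s) (hs : IsClosed s)
    (hO : IsOpen O) (hCO : (C \ {A, B}) ∩ O = s \ {A, B}) (hpre : IsPreconnected (s \ {A, B}))
    (hne : (s \ {A, B}).Nonempty) : IsArc A B s := by
  obtain ⟨x, hx⟩ := hne
  refine ⟨hAB, C, s \ {A, B}, hC, hsC hA, hsC hB, ⟨x, ⟨hsC hx.1, hx.2⟩, ?_⟩, ?_⟩
  · refine (connectedComponentIn_eq_of_clopen hO hs hCO ?_ hpre hx).symm
    ext y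
    exact ⟨fun h => ⟨h.2, h.1.2⟩, fun h => ⟨⟨hsC h.1, h.2⟩, h.1⟩⟩
  · rw [Set.union_sdiff_cancel]
    rintro y (rfl | rfl)
    exacts [hA, hB]

theorem isComponentOf_iff {D R K U : Set (OnePoint ℂ)} (hK : K = D ∪ R) (hDR : Disjoint D R)
    (hD : IsOpen D) (hR : IsOpen R) (hDc : IsPreconnected D) (hRc : IsPreconnected R)
    (hDn : D.Nonempty) (hRn : R.Nonempty) : IsComponentOf U K ↔ U = D ∨ U = R := by
  have h1 : ∀ x ∈ D, connectedComponentIn K x = D := fun x hx => by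
    refine connectedComponentIn_eq_of_clopen hD hR.isClosed_compl ?_ ?_ hDc hx
    · rw [hK]; exact Set.inter_eq_right.2 Set.subset_union_left
    · rw [hK, Set.union_inter_distrib_right, Set.inter_compl_self, Set.union_empty]
      exact Set.inter_eq_left.2 (Set.disjoint_left.1 hDR)
  have h2 : ∀ x ∈ R, connectedComponentIn K x = R := fun x hx => by
    refine connectedComponentIn_eq_of_clopen hR hD.isClosed_compl ?_ ?_ hRc hx
    · rw [hK]; exact Set.inter_eq_right.2 Set.subset_union_right
    · rw [hK, Set.union_inter_distrib_right, Set.inter_compl_self, Set.empty_union]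
      exact Set.inter_eq_left.2 (Set.disjoint_right.1 hDR)
  constructor
  · rintro ⟨x, hx, rfl⟩
    rw [hK] at hx
    rcases hx with hx | hx
    · exact Or.inl (h1 x hx)
    · exact Or.inr (h2 x hx)
  · rintro (rfl | rfl)
    · obtain ⟨x, hx⟩ := hDn
      exact ⟨x, hK ▸ Or.inl hx, (h1 x hx).symm⟩
    · obtain ⟨x, hx⟩ := hRn
      exact ⟨x, hK ▸ Or.inr hx, (h2 x hx).symm⟩

/-- The line through `A` and `B`, together with `∞`. -/
def lineInfty (A B : ℂ) : Set (OnePoint ℂ) :=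
  insert ∞ ((fun z : ℂ => (z : OnePoint ℂ)) '' {z : ℂ | ∃ t : ℝ, z = A + t * (B - A)})

theorem isCircline_lineInfty {A B : ℂ} (h : A ≠ B) : IsCircline (lineInfty A B) :=
  Or.inr ⟨A, B - A, sub_ne_zero.2 h.symm, rfl⟩

theorem segment_subset_lineInfty (A B : ℂ) :
    (fun z : ℂ => (z : OnePoint ℂ)) '' segment ℝ A B ⊆ lineInfty A B := by
  rintro _ ⟨z, hz, rfl⟩
  rw [segment_eq_image'] at hz
  obtain ⟨t, -, rfl⟩ := hz
  exact Or.inr ⟨_, ⟨t, by simp⟩, rfl⟩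

theorem openSegment_eq_diff {A B : ℂ} (h : A ≠ B) :
    segment ℝ A B \ {A, B} = openSegment ℝ A B := by
  rw [← insert_endpoints_openSegment]
  ext z
  constructor
  · rintro ⟨rfl | rfl | hz, h2⟩
    · simp at h2
    · simp at h2
    · exact hz
  · intro hz
    refine ⟨Or.inr (Or.inr hz), ?_⟩
    rintro (rfl | rfl)
    · exact h (left_mem_openSegment_iff.1 hz)
    · exact h (right_mem_openSegment_iff.1 hz)

/-- A straight line segment is an arc: the open disk that has it as diameter separates it from
the rest of its line. -/
theorem isArc_segment {A B : ℂ} (h : A ≠ B) :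
    IsArc (A : OnePoint ℂ) (B : OnePoint ℂ)
      ((fun z : ℂ => (z : OnePoint ℂ)) '' segment ℝ A B) := by
  have hd : ((fun z : ℂ => (z : OnePoint ℂ)) '' segment ℝ A B) \ {(A : OnePoint ℂ), ↑B} =
      (fun z : ℂ => (z : OnePoint ℂ)) '' openSegment ℝ A B := by
    rw [← openSegment_eq_diff h, Set.image_sdiff OnePoint.coe_injective, Set.image_pair]
  have hn : 0 < ‖B - A‖ := norm_pos_iff.2 (sub_ne_zero.2 h.symm)
  refine isArc_of_isOpen (C := lineInfty A B)
    (O := (fun z : ℂ => (z : OnePoint ℂ)) '' Metric.ball ((A + B) / 2) (‖B - A‖ / 2))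
    (fun h0 => h (OnePoint.coe_injective h0)) (isCircline_lineInfty h)
    (segment_subset_lineInfty A B) ⟨A, left_mem_segment ℝ A B, rfl⟩
    ⟨B, right_mem_segment ℝ A B, rfl⟩ ?_ (OnePoint.isOpen_image_coe.2 Metric.isOpen_ball) ?_ ?_ ?_
  · have : IsCompact (segment ℝ A B) := by
      rw [segment_eq_image']
      exact isCompact_Icc.image (by fun_prop)
    exact (this.image OnePoint.continuous_coe).isClosed
  · have key : ∀ t : ℝ, A + t * (B - A) ∈ Metric.ball ((A + B) / 2) (‖B - A‖ / 2) ↔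
        0 < t ∧ t < 1 := by
      intro t
      have : A + t * (B - A) - (A + B) / 2 = ((t - 1 / 2 : ℝ) : ℂ) * (B - A) := by
        push_cast; ring
      rw [mem_ball_iff_norm, this, norm_mul, Complex.norm_real, Real.norm_eq_abs,
        show ‖B - A‖ / 2 = 1 / 2 * ‖B - A‖ by ring, mul_lt_mul_iff_left₀ hn, abs_lt]
      constructor
      · rintro ⟨h1, h2⟩; constructor <;> linarith
      · rintro ⟨h1, h2⟩; constructor <;> linarith
    rw [hd]
    ext x
    constructor
    · rintro ⟨⟨hx1, -⟩, z, hz, rfl⟩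
      rcases hx1 with hx1 | ⟨w, ⟨t, ht⟩, hw⟩
      · exact absurd hx1 (OnePoint.coe_ne_infty z)
      · obtain rfl : w = z := OnePoint.coe_injective hw
        rw [ht, key] at hz
        refine ⟨w, ?_, rfl⟩
        rw [openSegment_eq_image']
        exact ⟨t, hz, by simp [ht]⟩
    · intro hx
      refine ⟨?_, ?_⟩
      · rw [← hd] at hx
        exact ⟨segment_subset_lineInfty A B hx.1, hx.2⟩
      · obtain ⟨z, hz, rfl⟩ := hx
        rw [openSegment_eq_image'] at hz
        obtain ⟨t, ht, rfl⟩ := hz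
        exact ⟨_, by simpa using (key t).2 ht, rfl⟩
  · rw [hd]
    exact (convex_openSegment A B).isPreconnected.image _ OnePoint.continuous_coe.continuousOn
  · rw [hd]
    exact ⟨_, _, ⟨1 / 2, 1 / 2, by norm_num, by norm_num, by norm_num, rfl⟩, rfl⟩

/-- A circline through three points of a line is that line. -/
theorem circline_of_segment {A B : ℂ} (h : A ≠ B) {C : Set (OnePoint ℂ)} (hC : IsCircline C)
    (hs : (fun z : ℂ => (z : OnePoint ℂ)) '' segment ℝ A B ⊆ C) :
    ∃ a v : ℂ, v ≠ 0 ∧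
      C = insert ∞ ((fun z : ℂ => (z : OnePoint ℂ)) '' {z : ℂ | ∃ t : ℝ, z = a + t * v}) := by
  rcases hC with ⟨c, R, hR, rfl⟩ | hC
  · exfalso
    rw [Set.image_subset_image_iff OnePoint.coe_injective] at hs
    have h1 := mem_sphere_iff_norm.1 (hs (left_mem_segment ℝ A B))
    have h2 := mem_sphere_iff_norm.1 (hs (right_mem_segment ℝ A B))
    have h3 := mem_sphere_iff_norm.1 (hs (midpoint_mem_segment A B))
    have h4 := parallelogram_law_with_norm ℝ (A - c) (B - c)
    have h5 : A - c + (B - c) = 2 * (midpoint ℝ A B - c) := by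
      rw [midpoint_eq_smul_add]; simp; ring
    rw [h5, norm_mul, h1, h2, h3] at h4
    have h6 : A - c - (B - c) = A - B := by ring
    rw [h6] at h4
    have h7 := norm_pos_iff.2 (sub_ne_zero.2 h)
    simp at h4
    nlinarith
  · exact hC

/-! ### The chart at the vertex `A₀` -/

theorem vertA_ne_zero (h : ℝ) : vertA h ≠ 0 := fun h0 => by
  have := congrArg Complex.re h0
  simp [vertA] at this

theorem vertQ_ne_zero {h t : ℝ} (H : FareyParam h t) : vertQ h t ≠ 0 := fun h0 => by
  have := congrArg Complex.re h0
  simp only [vertQ, Complex.zero_re] at this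
  linarith [H.two_lt]

theorem vertQ_ne_vertA {h t : ℝ} (H : FareyParam h t) : vertQ h t ≠ vertA h := fun h0 => by
  have := congrArg Complex.re h0
  simp only [vertQ, vertA] at this
  linarith [H.two_lt]

theorem vertA_sub (h : ℝ) : vertA h - vertA (-h) = 2 * Complex.I * h := by
  apply Complex.ext <;> simp [vertA]; ring

theorem vertA_add (h : ℝ) : vertA h + vertA (-h) = 2 := by
  apply Complex.ext <;> simp [vertA]; norm_num

theorem vertA_ne_neg {h : ℝ} (hh : h ≠ 0) : vertA h ≠ vertA (-h) := fun h0 => by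
  have := congrArg Complex.im h0
  simp only [vertA] at this
  exact hh (by linarith)

/-- The parametrization `u ↦ 1 - 2 / u` of the sphere, which takes `∞` to the vertex `A₀ = 1`. -/
def chart : OnePoint ℂ ≃ₜ OnePoint ℂ := Homeomorph.smul (glMk 1 (-2) 1 0 (by norm_num))

theorem chart_apply (w : OnePoint ℂ) : chart w = fracLin 1 (-2) 1 0 w :=
  glMk_smul _ w

theorem chart_infty : chart ∞ = ((1 : ℂ) : OnePoint ℂ) := by
  simp [chart_apply, fracLin_infty]

theorem chart_zero : chart ((0 : ℂ) : OnePoint ℂ) = ∞ := by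
  simp [chart_apply, fracLin_coe]

theorem chart_coe {u : ℂ} (hu : u ≠ 0) :
    chart (u : OnePoint ℂ) = ((1 - 2 / u : ℂ) : OnePoint ℂ) := by
  simp only [chart_apply, fracLin_coe, one_mul, add_zero, if_neg hu]
  congr 1
  field_simp
  ring

/-- The map `T₊` (for `h > 0`) or `T₋` (for `h < 0`) in the parametrization `chart`. -/
def sphU (h t : ℝ) : OnePoint ℂ → OnePoint ℂ :=
  fracLin (vertQ h t) (-(vertQ h t * vertA (-h)) - vertA h ^ 2 + vertA h * vertA (-h)) 1
    (-vertA h)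

theorem sphU_det {h t : ℝ} (H : FareyParam h t) :
    vertQ h t * (-vertA h) - (-(vertQ h t * vertA (-h)) - vertA h ^ 2 + vertA h * vertA (-h)) * 1
      ≠ 0 := by
  have : vertQ h t * (-vertA h) -
      (-(vertQ h t * vertA (-h)) - vertA h ^ 2 + vertA h * vertA (-h)) * 1 =
      (vertA h - vertQ h t) * (vertA h - vertA (-h)) := by ring
  rw [this]
  exact mul_ne_zero (sub_ne_zero.2 (vertQ_ne_vertA H).symm) (sub_ne_zero.2 (vertA_ne_neg H.ne))

theorem sphU_infty (h t : ℝ) : sphU h t ∞ = (vertQ h t : OnePoint ℂ) := by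
  simp [sphU, fracLin_infty]

theorem sphU_vertA (h t : ℝ) : sphU h t (vertA h : OnePoint ℂ) = ∞ := by
  simp [sphU, fracLin_coe]

theorem sphU_coe {h t : ℝ} {u : ℂ} (hu : u ≠ vertA h) :
    sphU h t (u : OnePoint ℂ) = (mapU h t u : OnePoint ℂ) := by
  have h1 : u - vertA h ≠ 0 := sub_ne_zero.2 hu
  have h2 : 1 * u + -vertA h ≠ 0 := by rwa [one_mul, ← sub_eq_add_neg]
  simp only [sphU, fracLin_coe, if_neg h2, mapU, ← vertA_sub]
  congr 1
  rw [one_mul, ← sub_eq_add_neg]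
  field_simp
  ring

theorem eUnit_add (x y : ℝ) : eUnit (x + y) = eUnit x * eUnit y := by
  simp only [eUnit, ← Complex.exp_add]
  congr 1
  push_cast; ring

theorem eUnit_zero : eUnit 0 = 1 := by simp [eUnit]

theorem eUnit_re (x : ℝ) : (eUnit x).re = Real.cos x := Complex.exp_ofReal_mul_I_re x

theorem eUnit_im (x : ℝ) : (eUnit x).im = Real.sin x := Complex.exp_ofReal_mul_I_im x

theorem cos_eq_eUnit (x : ℝ) : (Real.cos x : ℂ) = (eUnit x + eUnit (-x)) / 2 := by
  apply Complex.ext <;> simp [eUnit_re, eUnit_im, -Complex.ofReal_cos]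

theorem cos_mul_eUnit (x : ℝ) : (Real.cos x : ℂ) * eUnit x = (1 + eUnit (2 * x)) / 2 := by
  rw [cos_eq_eUnit, div_mul_eq_mul_div, add_mul, ← eUnit_add, ← eUnit_add, neg_add_cancel,
    eUnit_zero, ← two_mul, add_comm]

/-- In the parametrization `chart`, the maps `T₊` and `T₋` of `Br_{φ,ψ}` are the maps `sphU`. -/
theorem canonicalT_chart {φ ψ ε h t : ℝ} (H : FareyParam h t) (hε : ε = 1 ∨ ε = -1)
    (hA : eUnit (ε * φ) = 1 - 2 / vertA h) (hA' : eUnit (-(ε * φ)) = 1 - 2 / vertA (-h))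
    (hQ : bryoR φ ψ * eUnit (ε * ψ) = 1 - 2 / vertQ h t) :
    canonicalT φ ψ ε ∘ chart = chart ∘ sphU h t := by
  have ha := vertA_ne_zero h
  have hb := vertA_ne_zero (-h)
  have hq := vertQ_ne_zero H
  have hab := vertA_add h
  have hdet : (vertQ h t - vertA h) * (vertA h - vertA (-h)) ≠ 0 :=
    mul_ne_zero (sub_ne_zero.2 (vertQ_ne_vertA H)) (sub_ne_zero.2 (vertA_ne_neg H.ne))
  have hc1 : Real.cos φ = Real.cos (ε * φ) := by rcases hε with rfl | rfl <;> simp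
  have hc2 : Real.cos (φ / 2) = Real.cos (ε * (φ / 2)) := by
    rcases hε with rfl | rfl <;> simp
  have e1 : (Real.cos (φ / 2) : ℂ) * eUnit (ε * (φ / 2)) = 1 - 1 / vertA h := by
    rw [hc2, cos_mul_eUnit, show 2 * (ε * (φ / 2)) = ε * φ by ring, hA]; ring
  have e2 : (Real.cos (φ / 2) : ℂ) * eUnit (-(ε * (φ / 2))) = 1 - 1 / vertA (-h) := by
    rw [hc2, ← Real.cos_neg, cos_mul_eUnit, show 2 * -(ε * (φ / 2)) = -(ε * φ) by ring, hA']
    ring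
  have e3 : (Real.cos φ : ℂ) = 1 - 1 / vertA h - 1 / vertA (-h) := by
    rw [hc1, cos_eq_eUnit, hA, hA']; ring
  have e4 : (bryoR φ ψ : ℂ) * Real.cos (φ / 2) * eUnit (ε * (ψ - φ / 2)) =
      (1 - 2 / vertQ h t) * (1 - 1 / vertA (-h)) := by
    rw [show ε * (ψ - φ / 2) = ε * ψ + -(ε * (φ / 2)) by ring, eUnit_add, ← hQ, ← e2]; ring
  have e5 : (bryoR φ ψ : ℂ) * (1 - 1 / vertA h - 1 / vertA (-h)) * eUnit (ε * ψ) =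
      (1 - 2 / vertQ h t) * (1 - 1 / vertA h - 1 / vertA (-h)) := by
    rw [← hQ]; ring
  funext w
  simp only [Function.comp, chart_apply, sphU, canonicalT, e1, e3, e4, e5, hQ]
  generalize vertQ h t = q at *
  generalize vertA h = a at *
  have hba : vertA (-h) = 2 - a := by rw [← hab]; ring
  rw [hba] at hb hdet ⊢
  have hk : a * (2 - a) * q ≠ 0 := mul_ne_zero (mul_ne_zero ha hb) hq
  have hT : fracLin (1 - 2 / q - (1 - 1 / a)) (1 - 1 / a - (1 - 2 / q) * (1 - 1 / a - 1 / (2 - a)))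
      ((1 - 2 / q) * (1 - 1 / (2 - a)) - (1 - 1 / a - 1 / (2 - a)))
      (1 - (1 - 2 / q) * (1 - 1 / (2 - a))) =
      fracLin (q * (2 - a) + a ^ 2 - a * (2 - a) - 2 * a)
        (2 * (q - 2) - (q * (2 - a) + a ^ 2 - a * (2 - a) - 2 * a))
        (q * (2 - a) + a ^ 2 - a * (2 - a))
        (2 * q - (q * (2 - a) + a ^ 2 - a * (2 - a))) := by
    funext z
    rw [← fracLin_scale hk]
    congr 1 <;> field_simp <;> ring
  rw [hT, fracLin_comp ?_ (by norm_num), fracLin_comp (by norm_num) ?_]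
  · rw [← fracLin_scale (two_ne_zero (α := ℂ)) (a := 1 * q + -2 * 1)]
    congr 1 <;> ring
  · intro h0; exact hdet (by linear_combination -h0)
  · intro h0; exact hdet (by linear_combination (-1 / 4) * h0)

/-! ### The edge `s₀` and its circline -/

theorem mem_affineSpan_vertical {c s : ℝ} (hs : s ≠ 0) (z : ℂ) :
    z ∈ affineSpan ℝ ({⟨c, s⟩, ⟨c, -s⟩} : Set ℂ) ↔ z.re = c := by
  rw [mem_affineSpan_pair_iff_exists_lineMap_eq]
  constructor
  · rintro ⟨r, rfl⟩
    simp [AffineMap.lineMap_apply]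
  · intro hz
    obtain ⟨r, hr⟩ : ∃ r, r * (2 * s) = s - z.im :=
      ⟨(s - z.im) / (2 * s), div_mul_cancel₀ _ (mul_ne_zero two_ne_zero hs)⟩
    refine ⟨r, ?_⟩
    apply Complex.ext
    · simp [AffineMap.lineMap_apply, hz]
    · simp [AffineMap.lineMap_apply]
      linarith

theorem wSameSide_vertical {c s : ℝ} (hs : s ≠ 0) (z w : ℂ) :
    (affineSpan ℝ ({⟨c, s⟩, ⟨c, -s⟩} : Set ℂ)).WSameSide z w ↔
      0 ≤ (z.re - c) * (w.re - c) := by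
  constructor
  · rintro ⟨p, hp, q, hq, hr⟩
    rw [mem_affineSpan_vertical hs] at hp hq
    simp only [vsub_eq_sub] at hr
    obtain ⟨v, a, b, ha, hb, -, h1, h2⟩ := hr.exists_eq_smul
    have h1 := congrArg Complex.re h1
    have h2 := congrArg Complex.re h2
    simp at h1 h2
    rw [← hp, h1, hp, ← hq, h2]
    nlinarith [mul_nonneg (mul_nonneg ha hb) (sq_nonneg v.re)]
  · intro h
    refine ⟨⟨c, z.im⟩, (mem_affineSpan_vertical hs _).2 rfl, ⟨c, w.im⟩,
      (mem_affineSpan_vertical hs _).2 rfl, ?_⟩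
    have e1 : z -ᵥ (⟨c, z.im⟩ : ℂ) = (z.re - c) • (1 : ℂ) := by
      apply Complex.ext <;> simp
    have e2 : w -ᵥ (⟨c, w.im⟩ : ℂ) = (w.re - c) • (1 : ℂ) := by
      apply Complex.ext <;> simp
    rw [e1, e2]
    rcases le_total 0 (z.re - c) with h1 | h1 <;> rcases le_total 0 (w.re - c) with h2 | h2
    · exact ((SameRay.refl (1 : ℂ)).nonneg_smul_left h1).nonneg_smul_right h2
    · rcases mul_eq_zero.1 (le_antisymm (mul_nonpos_of_nonneg_of_nonpos h1 h2) h) with h0 | h0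
      · rw [h0, zero_smul]; exact SameRay.zero_left _
      · rw [h0, zero_smul]; exact SameRay.zero_right _
    · rcases mul_eq_zero.1 (le_antisymm (mul_nonpos_of_nonpos_of_nonneg h1 h2) h) with h0 | h0
      · rw [h0, zero_smul]; exact SameRay.zero_left _
      · rw [h0, zero_smul]; exact SameRay.zero_right _
    · rw [← neg_neg (z.re - c), ← neg_neg (w.re - c), neg_smul, neg_smul (-(w.re - c)),
        sameRay_neg_iff]
      exact ((SameRay.refl (1 : ℂ)).nonneg_smul_left (neg_nonneg.2 h1)).nonneg_smul_right
        (neg_nonneg.2 h2)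

theorem segment_vertical {c s : ℝ} (hs : s ≠ 0) (hcs : c ^ 2 + s ^ 2 = 1) :
    segment ℝ (⟨c, s⟩ : ℂ) ⟨c, -s⟩ = {z | z.re = c ∧ Complex.normSq z ≤ 1} := by
  ext z
  rw [segment_eq_image']
  constructor
  · rintro ⟨θ, ⟨h0, h1⟩, rfl⟩
    refine ⟨by simp, ?_⟩
    simp [Complex.normSq_apply]
    have : 0 ≤ s ^ 2 * (θ * (1 - θ)) := mul_nonneg (sq_nonneg s) (mul_nonneg h0 (by linarith))
    nlinarith
  · rintro ⟨h1, h2⟩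
    rw [Complex.normSq_apply, h1] at h2
    have h3 : (z.im / s) ^ 2 ≤ 1 := by
      rw [div_pow, div_le_one (by positivity)]; nlinarith
    obtain ⟨h4, h5⟩ := abs_le.1 ((sq_le_one_iff_abs_le_one _).1 h3)
    refine ⟨(1 - z.im / s) / 2, ⟨by linarith, by linarith⟩, ?_⟩
    apply Complex.ext
    · simp [h1]
    · simp
      field_simp
      ring

/-- The arc of a circle through `c ± i s` and `Q`, cut off by the line through `c ± i s` on the
side of `Q`, is the part in the unit disk of a circle of the pencil spanned by the unit circle
and that line. -/
theorem arc_vertical {c s p N : ℝ} (hs : s ≠ 0) (hcs : c ^ 2 + s ^ 2 = 1) (hp : p ≠ 0)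
    (hN : 0 < N) {Q : ℂ} (hQ : p * (Complex.normSq Q - 1) + 2 * N * (Q.re - c) = 0)
    (hQ1 : Complex.normSq Q < 1) :
    {z : ℂ | EuclideanGeometry.Cospherical ({⟨c, s⟩, ⟨c, -s⟩, Q, z} : Set ℂ) ∧
        (affineSpan ℝ ({⟨c, s⟩, ⟨c, -s⟩} : Set ℂ)).WSameSide z Q} =
      {z | p * (Complex.normSq z - 1) + 2 * N * (z.re - c) = 0 ∧ Complex.normSq z ≤ 1} := by
  have hQc : Q.re - c ≠ 0 := by
    intro h0
    rw [h0, mul_zero, add_zero] at hQ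
    rcases mul_eq_zero.1 hQ with h | h
    · exact hp h
    · linarith
  have hside : ∀ z : ℂ, p * (Complex.normSq z - 1) + 2 * N * (z.re - c) = 0 →
      (0 ≤ (z.re - c) * (Q.re - c) ↔ Complex.normSq z ≤ 1) := by
    intro z hz
    have h1 : (2 * N) ^ 2 * ((z.re - c) * (Q.re - c)) =
        (p ^ 2 * (1 - Complex.normSq Q)) * (1 - Complex.normSq z) := by
      have e1 : 2 * N * (z.re - c) = p * (1 - Complex.normSq z) := by linarith
      have e2 : 2 * N * (Q.re - c) = p * (1 - Complex.normSq Q) := by linarith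
      calc _ = (2 * N * (z.re - c)) * (2 * N * (Q.re - c)) := by ring
        _ = _ := by rw [e1, e2]; ring
    have h2 : 0 < p ^ 2 * (1 - Complex.normSq Q) := mul_pos (by positivity) (by linarith)
    have h3 : 0 < (2 * N) ^ 2 := by positivity
    constructor
    · intro h
      have := mul_nonneg h3.le h
      rw [h1] at this
      linarith [nonneg_of_mul_nonneg_right this h2]
    · intro h
      have := mul_nonneg h2.le (sub_nonneg.2 h)
      rw [← h1] at this
      exact nonneg_of_mul_nonneg_right this h3
  have hsq : ∀ (z w : ℂ) (R : ℝ), dist z w = R →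
      (z.re - w.re) ^ 2 + (z.im - w.im) ^ 2 = R ^ 2 := by
    intro z w R h
    rw [← h, dist_eq_norm, ← Complex.normSq_eq_norm_sq, Complex.normSq_apply]
    simp; ring
  ext z
  simp only [Set.mem_ofPred_eq, wSameSide_vertical hs]
  have hcirc : EuclideanGeometry.Cospherical ({⟨c, s⟩, ⟨c, -s⟩, Q, z} : Set ℂ) ↔
      p * (Complex.normSq z - 1) + 2 * N * (z.re - c) = 0 := by
    constructor
    · rintro ⟨w, R, hR⟩
      have h1 := hsq _ _ _ (hR ⟨c, s⟩ (by simp))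
      have h2 := hsq _ _ _ (hR ⟨c, -s⟩ (by simp))
      have h3 := hsq _ _ _ (hR Q (by simp))
      have h4 := hsq _ _ _ (hR z (by simp))
      simp only at h1 h2
      have h5 : w.im = 0 := by
        have : s * w.im = 0 := by linarith
        exact (mul_eq_zero.1 this).resolve_left hs
      rw [h5] at h1 h3 h4
      rw [Complex.normSq_apply] at hQ ⊢
      have h6 : (Q.re - c) * (p * w.re + N) = 0 := by
        linear_combination (1 / 2) * hQ - p / 2 * h3 + p / 2 * h1 - p / 2 * hcs
      have h7 := (mul_eq_zero.1 h6).resolve_left hQc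
      linear_combination p * h4 - p * h1 + p * hcs + 2 * (z.re - c) * h7
    · intro hz
      refine ⟨((-N / p : ℝ) : ℂ), Real.sqrt (1 + 2 * (N / p) * c + (N / p) ^ 2), ?_⟩
      have key : ∀ v : ℂ, p * (Complex.normSq v - 1) + 2 * N * (v.re - c) = 0 →
          dist v ((-N / p : ℝ) : ℂ) = Real.sqrt (1 + 2 * (N / p) * c + (N / p) ^ 2) := by
        intro v hv
        rw [dist_eq_norm, Complex.norm_def]
        congr 1
        rw [Complex.normSq_apply] at hv ⊢
        simp
        field_simp
        linear_combination p * hv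
      intro v hv
      simp only [Set.mem_insert_iff, Set.mem_singleton_iff] at hv
      apply key
      rcases hv with rfl | rfl | rfl | rfl
      · rw [Complex.normSq_apply]; simp only; linear_combination p * hcs
      · rw [Complex.normSq_apply]; simp only; linear_combination p * hcs
      · exact hQ
      · exact hz
  rw [hcirc]
  exact and_congr_right (hside z)

/-- The equation of the circline of `s₀` in the coordinate `z`. -/
def circZ (h t : ℝ) (z : ℂ) : ℝ :=
  circP h t * (Complex.normSq z - 1) +
    2 * (1 + h ^ 2) * (z.re - (h ^ 2 - 1) / (1 + h ^ 2))

theorem one_sub_two_div_vertA (h : ℝ) : 1 - 2 / vertA h =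
    (⟨(h ^ 2 - 1) / (1 + h ^ 2), 2 * h / (1 + h ^ 2)⟩ : ℂ) := by
  have hN : 1 + h ^ 2 ≠ 0 := by positivity
  have hN' : 1 + h * h ≠ 0 := by rwa [← sq]
  apply Complex.ext
  · simp [vertA, Complex.div_re, Complex.normSq_apply]; field_simp; ring
  · simp [vertA, Complex.div_im, Complex.normSq_apply]; field_simp

theorem circZ_chart (h t : ℝ) {u : ℂ} (hu : u ≠ 0) :
    circZ h t (1 - 2 / u) = 4 * circF h t u / Complex.normSq u := by
  have h1 : Complex.normSq u ≠ 0 := by simpa using hu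
  have hN : 1 + h ^ 2 ≠ 0 := by positivity
  rw [Complex.normSq_apply] at h1
  have h1' : u.re ^ 2 + u.im ^ 2 ≠ 0 := by rwa [sq, sq]
  have h2 : (1 - 2 / u).re = 1 - 2 * u.re / (u.re * u.re + u.im * u.im) := by
    simp [Complex.div_re, Complex.normSq_apply]
  have h3 : (1 - 2 / u).im = 2 * u.im / (u.re * u.re + u.im * u.im) := by
    simp [Complex.div_im, Complex.normSq_apply]
  rw [circZ, Complex.normSq_apply, h2, h3, Complex.normSq_apply, circF]
  field_simp
  ring

theorem normSq_chart {u : ℂ} (hu : u ≠ 0) :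
    Complex.normSq (1 - 2 / u) = 1 - 4 * (u.re - 1) / Complex.normSq u := by
  have h1 : Complex.normSq u ≠ 0 := by simpa using hu
  have h2 : 1 - 2 / u = (u - 2) / u := by field_simp
  rw [h2, Complex.normSq_div, Complex.normSq_apply (u - 2)]
  field_simp
  rw [Complex.normSq_apply]
  simp; ring

theorem circZ_one {h t : ℝ} : circZ h t 1 = 4 := by
  have hN : 1 + h ^ 2 ≠ 0 := by positivity
  simp [circZ]; field_simp; ring

/-- In the coordinate `z` the edge `s₀` is the part of its circline in the closed unit disk,
whether it is an arc of a circle or a segment. -/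
theorem arc0_image (h t : ℝ) :
    chart '' ((fun z : ℂ => (z : OnePoint ℂ)) '' arc0 h t) =
      (fun z : ℂ => (z : OnePoint ℂ)) '' {z | circZ h t z = 0 ∧ Complex.normSq z ≤ 1} := by
  have key : ∀ u : ℂ, u ≠ 0 →
      (u ∈ arc0 h t ↔ circZ h t (1 - 2 / u) = 0 ∧ Complex.normSq (1 - 2 / u) ≤ 1) := by
    intro u hu
    have h1 := Complex.normSq_pos.2 hu
    rw [circZ_chart h t hu, normSq_chart hu, arc0, Set.mem_ofPred_eq, and_comm,
      div_eq_zero_iff, or_iff_left h1.ne', mul_eq_zero, or_iff_right (by norm_num)]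
    refine and_congr_right fun _ => ?_
    rw [sub_le_self_iff, le_div_iff₀ h1, zero_mul]
    constructor <;> intro <;> linarith
  ext x
  constructor
  · rintro ⟨_, ⟨u, hu, rfl⟩, rfl⟩
    have hu0 : u ≠ 0 := by rintro rfl; have := hu.1; simp at this; linarith
    exact ⟨1 - 2 / u, (key u hu0).1 hu, (chart_coe hu0).symm⟩
  · rintro ⟨z, hz, rfl⟩
    have hz1 : 1 - z ≠ 0 := by
      intro h0
      have := hz.1
      rw [← sub_eq_zero.1 h0, circZ_one] at this
      norm_num at this
    have hu0 : 2 / (1 - z) ≠ 0 := div_ne_zero two_ne_zero hz1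
    have e : 1 - 2 / (2 / (1 - z)) = z := by field_simp; ring
    refine ⟨_, ⟨2 / (1 - z), (key _ hu0).2 (by rwa [e]), rfl⟩, ?_⟩
    simp only [chart_coe hu0, e]

/-- The condition `ψ = φ / 2` under which `s₀` is a segment is the condition that the circline of
`s₀` is a line. -/
theorem canonicalS0_eq {φ ψ h t : ℝ} (H : FareyParam h t)
    (hA : eUnit φ = 1 - 2 / vertA h) (hA' : eUnit (-φ) = 1 - 2 / vertA (-h))
    (hQ : bryoR φ ψ * eUnit ψ = 1 - 2 / vertQ h t) (hp : ψ = φ / 2 ↔ circP h t = 0) :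
    canonicalS0 φ ψ = {z | circZ h t z = 0 ∧ Complex.normSq z ≤ 1} := by
  have hN : 0 < 1 + h ^ 2 := by positivity
  have hs : 2 * h / (1 + h ^ 2) ≠ 0 := div_ne_zero (mul_ne_zero two_ne_zero H.ne) hN.ne'
  have hcs : ((h ^ 2 - 1) / (1 + h ^ 2)) ^ 2 + (2 * h / (1 + h ^ 2)) ^ 2 = 1 := by
    field_simp; ring
  have hq := vertQ_ne_zero H
  have e1 := one_sub_two_div_vertA h
  have e2 := one_sub_two_div_vertA (-h)
  rw [neg_sq, mul_neg, neg_div] at e2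
  rw [canonicalS0, hQ, hA, hA', e1, e2]
  split_ifs with h0
  · rw [segment_vertical hs hcs]
    ext z
    simp only [circZ, hp.1 h0, zero_mul, zero_add, Set.mem_ofPred_eq, mul_eq_zero, hN.ne',
      two_ne_zero, false_or, sub_eq_zero]
  · refine arc_vertical hs hcs (fun h1 => h0 (hp.2 h1)) hN ?_ ?_
    · have := circZ_chart h t hq
      rwa [circF_vertQ, mul_zero, zero_div] at this
    · rw [normSq_chart hq]
      have h1 := Complex.normSq_pos.2 hq
      have h2 : 0 < 4 * ((vertQ h t).re - 1) / Complex.normSq (vertQ h t) := by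
        refine div_pos ?_ h1
        simp only [vertQ]
        linarith [H.two_lt]
      linarith

/-- The zero set of `circZ`, together with `∞` if it is a line. -/
theorem exists_circline (h t : ℝ) (hh : h ≠ 0) :
    ∃ C : Set (OnePoint ℂ), IsCircline C ∧ (∀ z : ℂ, (z : OnePoint ℂ) ∈ C ↔ circZ h t z = 0) ∧
      (circP h t = 0 → ∞ ∈ C) := by
  have hN : 0 < 1 + h ^ 2 := by positivity
  obtain ⟨c, hc⟩ : ∃ c, c = (h ^ 2 - 1) / (1 + h ^ 2) := ⟨_, rfl⟩
  have hc1 : c ^ 2 < 1 := by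
    rw [hc, div_pow, div_lt_one (by positivity)]
    have : 0 < h ^ 2 := by positivity
    nlinarith
  simp only [circZ, ← hc]
  by_cases hp : circP h t = 0
  · refine ⟨_, Or.inr ⟨c, Complex.I, Complex.I_ne_zero, rfl⟩, ?_, fun _ => Or.inl rfl⟩
    intro z
    simp only [hp, zero_mul, zero_add, mul_eq_zero, hN.ne', two_ne_zero, false_or,
      sub_eq_zero]
    constructor
    · rintro (h0 | ⟨w, ⟨r, rfl⟩, hw⟩)
      · exact absurd h0 (OnePoint.coe_ne_infty z)
      · rw [← OnePoint.coe_injective hw]; simp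
    · intro hz
      refine Or.inr ⟨z, ⟨z.im, ?_⟩, rfl⟩
      apply Complex.ext <;> simp [hz]
  · set k := (1 + h ^ 2) / circP h t with hk
    have hkp : circP h t * k = 1 + h ^ 2 := by rw [hk]; field_simp
    have hR : 0 < 1 + 2 * k * c + k ^ 2 := by nlinarith [sq_nonneg (k + c)]
    refine ⟨_, Or.inl ⟨((-k : ℝ) : ℂ), Real.sqrt (1 + 2 * k * c + k ^ 2), Real.sqrt_pos.2 hR,
      rfl⟩, ?_, fun h0 => absurd h0 hp⟩
    intro z
    have e : Complex.normSq (z - ((-k : ℝ) : ℂ)) - (1 + 2 * k * c + k ^ 2) =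
        (circP h t * (Complex.normSq z - 1) + 2 * (1 + h ^ 2) * (z.re - c)) / circP h t := by
      rw [eq_div_iff hp, Complex.normSq_apply, Complex.normSq_apply, ← hkp]
      simp; ring
    rw [OnePoint.coe_injective.mem_set_image, mem_sphere_iff_norm, Complex.norm_def,
      Real.sqrt_inj (Complex.normSq_nonneg _) hR.le, ← sub_eq_zero, e, div_eq_zero_iff,
      or_iff_left hp]

/-! ### The parameters of the canonical bryophyllum -/

/-- The witnesses are `h = cot (φ / 2)` and
`t = 2 cos (φ / 2) sin (ψ + φ / 2) / sin ψ`; the hypotheses exclude `ψ = 0`. -/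
theorem exists_fareyParam {φ ψ : ℝ} (hφ : φ ∈ Set.Ioo 0 Real.pi) (hψ : ψ ∈ Set.Icc 0 Real.pi)
    (h1 : 0 ≤ Real.sin ψ + 2 * Real.sin (ψ - φ / 2) * Real.cos (φ / 2))
    (h2 : 0 ≤ Real.sin ψ * Real.cos φ - 2 * Real.sin (ψ - φ / 2) * Real.cos (φ / 2))
    (h3 : φ + 2 * ψ < Real.pi) :
    ∃ h t : ℝ, FareyParam h t ∧ eUnit φ = 1 - 2 / vertA h ∧ eUnit (-φ) = 1 - 2 / vertA (-h) ∧
      bryoR φ ψ * eUnit ψ = 1 - 2 / vertQ h t ∧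
      bryoR φ ψ * eUnit (-ψ) = 1 - 2 / vertQ (-h) t ∧ (ψ = φ / 2 ↔ circP h t = 0) := by
  obtain ⟨x, rfl⟩ : ∃ x, φ = 2 * x := ⟨φ / 2, by ring⟩
  rw [mul_div_cancel_left₀ x two_ne_zero] at *
  have hx0 : 0 < x := by linarith [hφ.1]
  have hxπ : x < Real.pi / 2 := by linarith [hφ.2]
  have hπ := Real.pi_pos
  have hs : 0 < Real.sin x := Real.sin_pos_of_pos_of_lt_pi hx0 (by linarith)
  have hc : 0 < Real.cos x := Real.cos_pos_of_mem_Ioo ⟨by linarith, hxπ⟩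
  have hψ0 : 0 < ψ := by
    refine lt_of_le_of_ne hψ.1 ?_
    rintro rfl
    rw [Real.sin_zero, zero_sub, Real.sin_neg] at h1
    nlinarith
  have hS : 0 < Real.sin ψ := Real.sin_pos_of_pos_of_lt_pi hψ0 (by linarith [hφ.1])
  have hK : 0 < Real.cos (ψ + x) :=
    Real.cos_pos_of_mem_Ioo ⟨by linarith [hφ.1], by linarith [hφ.1]⟩
  have hcs := Real.sin_sq_add_cos_sq x
  have hCS := Real.sin_sq_add_cos_sq ψ
  have hne : (ψ = x ↔ Real.cos ψ * Real.sin x = Real.cos x * Real.sin ψ) := by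
    constructor
    · rintro rfl; ring
    · intro h
      have h4 : Real.sin (ψ - x) = 0 := by rw [Real.sin_sub]; linarith
      have := (Real.sin_eq_zero_iff_of_lt_of_lt (by linarith)
        (by linarith)).1 h4
      linarith
  have hadd := Real.sin_add ψ x
  have hadd' := Real.cos_add ψ x
  have hKS : Real.sin (ψ + x) ^ 2 + Real.cos (ψ + x) ^ 2 = 1 := Real.sin_sq_add_cos_sq _
  rw [Real.sin_sub] at h1 h2
  rw [Real.cos_two_mul] at h2
  have hrr : bryoR (2 * x) ψ = Real.cos (ψ + x) / Real.cos x := by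
    rw [bryoR, mul_div_cancel_left₀ x two_ne_zero, add_comm]
  have hA1 : (eUnit (2 * x)).re = 2 * Real.cos x ^ 2 - 1 := by rw [eUnit_re, Real.cos_two_mul]
  have hA2 : (eUnit (2 * x)).im = 2 * Real.sin x * Real.cos x := by
    rw [eUnit_im, Real.sin_two_mul]
  have hB1 : (eUnit (-(2 * x))).re = 2 * Real.cos x ^ 2 - 1 := by
    rw [eUnit_re, Real.cos_neg, Real.cos_two_mul]
  have hB2 : (eUnit (-(2 * x))).im = -(2 * Real.sin x * Real.cos x) := by
    rw [eUnit_im, Real.sin_neg, Real.sin_two_mul]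
  have hQ1 := eUnit_re ψ
  have hQ2 := eUnit_im ψ
  have hR1 := eUnit_re (-ψ)
  have hR2 := eUnit_im (-ψ)
  rw [Real.cos_neg] at hR1
  rw [Real.sin_neg] at hR2
  -- the formulas of angle subtraction for `x = (ψ + x) - ψ`
  have hx1 : Real.cos x = Real.sin (ψ + x) * Real.sin ψ + Real.cos (ψ + x) * Real.cos ψ := by
    rw [hadd, hadd']; linear_combination (-Real.cos x) * hCS
  have hx2 : Real.sin x = Real.sin (ψ + x) * Real.cos ψ - Real.cos (ψ + x) * Real.sin ψ := by
    rw [hadd, hadd']; linear_combination (-Real.sin x) * hCS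
  rw [hrr]
  generalize Real.sin (ψ + x) = σ at *
  generalize Real.cos (ψ + x) = κ at *
  generalize Real.sin ψ = S at *
  generalize Real.cos ψ = C at *
  generalize Real.sin x = s at *
  generalize Real.cos x = c at *
  have hcs' : 1 + (c / s) ^ 2 = 1 / s ^ 2 := by field_simp; linarith
  have ht2 : 2 * c * σ / S - 2 = 2 * s * κ / S := by
    field_simp
    rw [hadd, hadd']
    linear_combination S * hcs
  have hq : vertQ (c / s) (2 * c * σ / S) = ⟨2 * c * σ / S, 2 * c * κ / S⟩ := by
    rw [vertQ, ht2]
    congr 1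
    field_simp
  have hq' : vertQ (-(c / s)) (2 * c * σ / S) = ⟨2 * c * σ / S, -(2 * c * κ / S)⟩ := by
    rw [vertQ, ht2]
    congr 1
    field_simp
  have hF : FareyParam (c / s) (2 * c * σ / S) := by
    refine ⟨by positivity, ?_, ?_, ?_⟩
    · have : 0 < 2 * s * κ / S := by positivity
      linarith
    · have e : 2 * c * σ / S * (1 + (c / s) ^ 2) - (1 + 3 * (c / s) ^ 2) =
          (S * (2 * c ^ 2 - 1) - 2 * (S * c - C * s) * c) / (S * s ^ 2) := by
        rw [hcs', hadd]
        field_simp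
        linear_combination (-S) * hcs
      have := div_nonneg h2 (by positivity : 0 ≤ S * s ^ 2)
      rw [← e] at this
      linarith
    · have e : 1 + 5 * (c / s) ^ 2 - 2 * c * σ / S * (1 + (c / s) ^ 2) =
          (S + 2 * (S * c - C * s) * c) / (S * s ^ 2) := by
        rw [hcs', hadd]
        field_simp
        linear_combination S * hcs
      have := div_nonneg h1 (by positivity : 0 ≤ S * s ^ 2)
      rw [← e] at this
      linarith
  have hn : 2 * c * σ / S * (2 * c * σ / S) + 2 * c * κ / S * (2 * c * κ / S) =
      4 * c ^ 2 / S ^ 2 := by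
    field_simp
    linear_combination 4 * hKS
  refine ⟨c / s, 2 * c * σ / S, hF, ?_, ?_, ?_, ?_, ?_⟩
  · rw [one_sub_two_div_vertA, hcs']
    apply Complex.ext
    · rw [hA1]; field_simp; linear_combination hcs
    · rw [hA2]; field_simp
  · rw [one_sub_two_div_vertA, neg_sq, hcs']
    apply Complex.ext
    · rw [hB1]; field_simp; linear_combination hcs
    · rw [hB2]; field_simp
  · rw [hq]
    apply Complex.ext
    · rw [Complex.re_ofReal_mul, hQ1, Complex.sub_re, Complex.div_re, Complex.normSq_apply]
      simp only [hn, Complex.one_re, Complex.re_ofNat, Complex.im_ofNat, zero_mul, zero_div,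
        add_zero]
      field_simp
      linear_combination (-4 : ℝ) * hx1
    · rw [Complex.im_ofReal_mul, hQ2, Complex.sub_im, Complex.div_im, Complex.normSq_apply]
      simp only [hn, Complex.one_im, Complex.re_ofNat, Complex.im_ofNat, zero_mul, zero_div,
        zero_sub]
      field_simp
      ring
  · rw [hq']
    apply Complex.ext
    · rw [Complex.re_ofReal_mul, hR1, Complex.sub_re, Complex.div_re, Complex.normSq_apply]
      simp only [neg_mul_neg, hn, Complex.one_re, Complex.re_ofNat, Complex.im_ofNat, zero_mul,
        zero_div, add_zero]
      field_simp
      linear_combination (-4 : ℝ) * hx1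
    · rw [Complex.im_ofReal_mul, hR2, Complex.sub_im, Complex.div_im, Complex.normSq_apply]
      simp only [neg_mul_neg, hn, Complex.one_im, Complex.re_ofNat, Complex.im_ofNat, zero_mul,
        zero_div, zero_sub]
      field_simp
      ring
  · have e : circP (c / s) (2 * c * σ / S) = 2 * c / (S * s ^ 2) * (C * s - c * S) := by
      have : circP (c / s) (2 * c * σ / S) =
          2 * c * σ / S * (1 + (c / s) ^ 2) - 4 * (c / s) ^ 2 := by rw [circP]; ring
      rw [this, hcs', hadd]
      field_simp
      ring
    have h0 : 2 * c / (S * s ^ 2) ≠ 0 := by positivity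
    rw [hne, e, mul_eq_zero, or_iff_right h0, sub_eq_zero]

/-! ### The edges in the chart -/

/-- The straight edge from `1 - 2 / vertA h` to the vertex `A₀ = 1`, which is the ray `ray h`
together with `∞` in the parametrization `chart`. -/
def edge (h : ℝ) : Set (OnePoint ℂ) :=
  chart '' insert ∞ ((fun z : ℂ => (z : OnePoint ℂ)) '' ray h)

theorem ray_eq_smul {h : ℝ} {u : ℂ} : u ∈ ray h ↔ ∃ l : ℝ, 1 ≤ l ∧ u = l * vertA h := by
  constructor
  · rintro ⟨h1, h2⟩
    refine ⟨u.re, h1, ?_⟩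
    apply Complex.ext
    · simp [vertA]
    · simp [vertA, h2, mul_comm]
  · rintro ⟨l, hl, rfl⟩
    exact ⟨by simpa [vertA] using hl, by simp [vertA, mul_comm]⟩

theorem edge_eq_segment (h : ℝ) :
    edge h = (fun z : ℂ => (z : OnePoint ℂ)) '' segment ℝ (1 - 2 / vertA h) 1 := by
  have ha := vertA_ne_zero h
  rw [segment_eq_image']
  ext x
  constructor
  · rintro ⟨w, rfl | ⟨u, hu, rfl⟩, rfl⟩
    · rw [chart_infty]
      exact ⟨1, ⟨1, by simp, by simp⟩, rfl⟩
    · obtain ⟨l, hl, rfl⟩ := ray_eq_smul.1 hu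
      have hl0 : (l : ℂ) ≠ 0 := by exact_mod_cast (by linarith : l ≠ 0)
      have hl1 : 0 < l := by linarith
      simp only [chart_coe (mul_ne_zero hl0 ha)]
      refine ⟨_, ⟨1 - l⁻¹, ⟨?_, ?_⟩, rfl⟩, ?_⟩
      · have := (inv_le_one₀ hl1).2 hl; linarith
      · have := inv_pos.2 hl1; linarith
      · congr 1
        simp only [Complex.real_smul]
        push_cast
        field_simp
        ring
  · rintro ⟨_, ⟨θ, ⟨h0, h1⟩, rfl⟩, rfl⟩
    rcases h1.lt_or_eq with h1 | rfl
    · have h2 : 0 < 1 - θ := by linarith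
      have h2' : (1 - θ : ℂ) ≠ 0 := by exact_mod_cast h2.ne'
      refine ⟨_, Or.inr ⟨_, ray_eq_smul.2 ⟨(1 - θ)⁻¹, (one_le_inv₀ h2).2 (by linarith), rfl⟩,
        rfl⟩, ?_⟩
      have hne : (((1 - θ)⁻¹ : ℝ) : ℂ) * vertA h ≠ 0 :=
        mul_ne_zero (by exact_mod_cast (inv_pos.2 h2).ne') ha
      simp only [chart_coe hne]
      congr 1
      simp only [Complex.real_smul]
      push_cast
      field_simp
      ring
    · exact ⟨∞, Or.inl rfl, by rw [chart_infty]; simp⟩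

/-- The edge `s₀` of the bryophyllum. -/
def edge0 (h t : ℝ) : Set (OnePoint ℂ) :=
  chart '' ((fun z : ℂ => (z : OnePoint ℂ)) '' arc0 h t)

/-- The vertex `A₊` of the bryophyllum; `A₋` is `pointA (-h)`. -/
def pointA (h : ℝ) : OnePoint ℂ := ((1 - 2 / vertA h : ℂ) : OnePoint ℂ)

/-- The vertex `A₀` of the bryophyllum. -/
def pointO : OnePoint ℂ := ((1 : ℂ) : OnePoint ℂ)

theorem chart_vertA (h : ℝ) : chart (vertA h : OnePoint ℂ) = pointA h :=
  chart_coe (vertA_ne_zero h)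

theorem chart_infty' : chart ∞ = pointO := chart_infty

theorem edge0_neg (h t : ℝ) : edge0 (-h) t = edge0 h t := by rw [edge0, arc0_neg, edge0]

theorem mapU_vertA_neg {h t : ℝ} (hh : h ≠ 0) : mapU h t (vertA (-h)) = vertA h := by
  have h1 : vertA (-h) - vertA h ≠ 0 := sub_ne_zero.2 (vertA_ne_neg hh).symm
  rw [mapU, ← vertA_sub]
  field_simp
  ring

theorem mapU_injOn {h t : ℝ} (H : FareyParam h t) {u v : ℂ} (hu : u ≠ vertA h) (hv : v ≠ vertA h)
    (huv : mapU h t u = mapU h t v) : u = v := by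
  have h1 : sphU h t u = sphU h t v := by rw [sphU_coe hu, sphU_coe hv, huv]
  simp only [sphU, ← glMk_smul (sphU_det H)] at h1
  exact OnePoint.coe_injective ((MulAction.injective _) h1)

theorem sphU_continuous {h t : ℝ} (H : FareyParam h t) : Continuous (sphU h t) :=
  continuous_fracLin (sphU_det H)

theorem sphU_surjective {h t : ℝ} (H : FareyParam h t) : Function.Surjective (sphU h t) := by
  intro x
  obtain ⟨y, hy⟩ := MulAction.surjective (glMk _ _ _ _ (sphU_det H)) x
  exact ⟨y, by rw [sphU, ← glMk_smul (sphU_det H)]; exact hy⟩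

theorem vertQ_notMem_ray {h t : ℝ} (H : FareyParam h t) : vertQ h t ∉ ray h := by
  rintro ⟨-, h2⟩
  simp only [vertQ] at h2
  exact H.ne (by linarith)

theorem vertA_mem_arc0 (h t : ℝ) : vertA h ∈ arc0 h t := ⟨by simp [vertA], circF_vertA h t⟩

theorem vertQ_mem_arc0 {h t : ℝ} (H : FareyParam h t) : vertQ h t ∈ arc0 h t :=
  ⟨by simp only [vertQ]; linarith [H.two_lt], circF_vertQ h t⟩

theorem sphU_image_arc0 {h t : ℝ} (H : FareyParam h t) :
    sphU h t '' ((fun z : ℂ => (z : OnePoint ℂ)) '' arc0 h t) =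
      insert ∞ ((fun z : ℂ => (z : OnePoint ℂ)) '' ray h) := by
  apply Set.Subset.antisymm
  · rintro _ ⟨_, ⟨u, hu, rfl⟩, rfl⟩
    by_cases hua : u = vertA h
    · subst hua
      exact Or.inl (sphU_vertA h t)
    · exact Or.inr ⟨_, (mapU_arc0 H hua).2 hu, (sphU_coe hua).symm⟩
  · intro x hx
    obtain ⟨w, rfl⟩ := sphU_surjective H x
    refine ⟨w, ?_, rfl⟩
    induction w using OnePoint.rec with
    | infty =>
      rw [sphU_infty] at hx
      rcases hx with hx | ⟨v, hv, hvx⟩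
      · exact absurd hx (OnePoint.coe_ne_infty _)
      · rw [OnePoint.coe_injective hvx] at hv
        exact absurd hv (vertQ_notMem_ray H)
    | coe u =>
      refine ⟨u, ?_, rfl⟩
      by_cases hua : u = vertA h
      · subst hua; exact vertA_mem_arc0 h t
      · rw [sphU_coe hua] at hx
        rcases hx with hx | ⟨v, hv, hvx⟩
        · exact absurd hx (OnePoint.coe_ne_infty _)
        · rw [OnePoint.coe_injective hvx] at hv
          exact (mapU_arc0 H hua).1 hv

/-- Without its end points the edge `s₀` is connected, because `T₊` maps it onto `s₊` without its
end points. -/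
theorem isPreconnected_edge0_diff {h t : ℝ} (H : FareyParam h t) :
    IsPreconnected (edge0 h t \ {pointA h, pointA (-h)}) := by
  have hray : ray h \ {vertA h} = {u | 1 < u.re ∧ u.im = h * u.re} := by
    ext u
    constructor
    · rintro ⟨⟨h1, h2⟩, h3⟩
      refine ⟨lt_of_le_of_ne h1 fun h4 => h3 ?_, h2⟩
      exact Complex.ext h4.symm (by rw [h2, ← h4, mul_one]; rfl)
    · rintro ⟨h1, h2⟩
      refine ⟨⟨h1.le, h2⟩, ?_⟩
      rintro rfl
      simp [vertA] at h1
  have hconv : Convex ℝ (ray h \ {vertA h}) := by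
    rw [hray]
    rintro x ⟨hx1, hx2⟩ y ⟨hy1, hy2⟩ a b ha hb hab
    refine ⟨?_, ?_⟩
    · simp only [Complex.add_re, Complex.real_smul, Complex.mul_re, Complex.ofReal_re,
        Complex.ofReal_im, zero_mul, sub_zero]
      rcases ha.lt_or_eq with ha | ha
      · nlinarith
      · obtain rfl : b = 1 := by linarith
        rw [← ha]; linarith
    · simp [hx2, hy2]; ring
  set g := glMk _ _ _ _ (sphU_det H) with hg
  have hgU : ∀ w, g • w = sphU h t w := fun w => glMk_smul _ w
  have key : edge0 h t \ {pointA h, pointA (-h)} =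
      chart '' ((fun w : OnePoint ℂ => g⁻¹ • w) '' ((fun z : ℂ => (z : OnePoint ℂ)) ''
        (ray h \ {vertA h}))) := by
    rw [edge0, ← chart_vertA, ← chart_vertA, ← Set.image_pair, ← Set.image_sdiff chart.injective]
    congr 1
    ext w
    constructor
    · rintro ⟨⟨u, hu, rfl⟩, hne⟩
      have hua : u ≠ vertA h := fun h0 => hne (Or.inl (by rw [h0]))
      have hub : u ≠ vertA (-h) := fun h0 => hne (Or.inr (by rw [h0]; rfl))
      refine ⟨g • (u : OnePoint ℂ), ⟨mapU h t u, ⟨(mapU_arc0 H hua).2 hu, ?_⟩, ?_⟩, ?_⟩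
      · intro h0
        rw [Set.mem_singleton_iff, ← mapU_vertA_neg (t := t) H.ne] at h0
        exact hub (mapU_injOn H hua (vertA_ne_neg H.ne).symm h0)
      · rw [hgU, sphU_coe hua]
      · simp
    · rintro ⟨_, ⟨v, ⟨hv, hva⟩, rfl⟩, rfl⟩
      have h1 : (v : OnePoint ℂ) ∈ sphU h t '' ((fun z : ℂ => (z : OnePoint ℂ)) '' arc0 h t) := by
        rw [sphU_image_arc0 H]; exact Or.inr ⟨v, hv, rfl⟩
      obtain ⟨_, ⟨u, hu, rfl⟩, huv⟩ := h1
      simp only [← huv, ← hgU, inv_smul_smul]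
      refine ⟨⟨u, hu, rfl⟩, ?_⟩
      rintro (h0 | h0)
      · simp only at h0 huv
        rw [h0, sphU_vertA] at huv
        exact absurd huv (OnePoint.infty_ne_coe v)
      · simp only [Set.mem_singleton_iff] at h0 huv
        rw [h0, sphU_coe (vertA_ne_neg H.ne).symm, mapU_vertA_neg H.ne] at huv
        exact hva (OnePoint.coe_injective huv).symm
  rw [key]
  exact ((hconv.isPreconnected.image _ OnePoint.continuous_coe.continuousOn).image _
    (continuous_const_smul _).continuousOn).image _ chart.continuous.continuousOn

theorem pointA_ne_neg {h : ℝ} (hh : h ≠ 0) : pointA h ≠ pointA (-h) := by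
  rw [← chart_vertA, ← chart_vertA]
  exact fun h0 => vertA_ne_neg hh (OnePoint.coe_injective (chart.injective h0))

theorem pointO_ne_pointA (h : ℝ) : pointO ≠ pointA h := by
  rw [← chart_vertA, ← chart_infty']
  exact fun h0 => OnePoint.infty_ne_coe _ (chart.injective h0)

theorem pointA_mem_edge0 (h t : ℝ) : pointA h ∈ edge0 h t :=
  ⟨_, ⟨_, vertA_mem_arc0 h t, rfl⟩, chart_vertA h⟩

/-- The circline of `s₀` meets the open unit disk in the interior of the edge `s₀`. -/
theorem isArc_edge0 {h t : ℝ} (H : FareyParam h t) :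
    IsArc (pointA h) (pointA (-h)) (edge0 h t) := by
  obtain ⟨C, hC, hCz, -⟩ := exists_circline h t H.ne
  have hN : 0 < 1 + h ^ 2 := by positivity
  have hcs : ((h ^ 2 - 1) / (1 + h ^ 2)) ^ 2 + (2 * h / (1 + h ^ 2)) ^ 2 = 1 := by
    field_simp; ring
  have hball : ∀ z : ℂ, z ∈ Metric.ball (0 : ℂ) 1 ↔ Complex.normSq z < 1 := by
    intro z
    rw [mem_ball_zero_iff, Complex.normSq_eq_norm_sq, sq_lt_one_iff₀ (norm_nonneg z)]
  have hcirc : Continuous (circZ h t) := by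
    have := Complex.continuous_normSq
    unfold circZ
    fun_prop
  have hb : pointA (-h) ∈ edge0 h t := by rw [← edge0_neg]; exact pointA_mem_edge0 (-h) t
  refine isArc_of_isOpen (C := C)
    (O := (fun z : ℂ => (z : OnePoint ℂ)) '' Metric.ball (0 : ℂ) 1) (pointA_ne_neg H.ne) hC ?_
    (pointA_mem_edge0 h t) hb ?_ (OnePoint.isOpen_image_coe.2 Metric.isOpen_ball) ?_
    (isPreconnected_edge0_diff H) ?_
  · rw [edge0, arc0_image]
    rintro _ ⟨z, hz, rfl⟩
    exact (hCz z).2 hz.1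
  · rw [edge0, arc0_image]
    have h1 : {z | circZ h t z = 0 ∧ Complex.normSq z ≤ 1} =
        {z | circZ h t z = 0} ∩ Metric.closedBall 0 1 := by
      ext z
      rw [Set.mem_inter_iff, mem_closedBall_zero_iff, ← sq_le_one_iff₀ (norm_nonneg z),
        ← Complex.normSq_eq_norm_sq]
      rfl
    have h2 : IsCompact {z | circZ h t z = 0 ∧ Complex.normSq z ≤ 1} := by
      rw [h1]
      exact (isCompact_closedBall _ _).inter_left (isClosed_eq hcirc continuous_const)
    exact (h2.image OnePoint.continuous_coe).isClosed
  · rw [edge0, arc0_image]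
    ext x
    constructor
    · rintro ⟨⟨hx, hne⟩, z, hz, rfl⟩
      exact ⟨⟨z, ⟨(hCz z).1 hx, ((hball z).1 hz).le⟩, rfl⟩, hne⟩
    · rintro ⟨⟨z, ⟨hz1, hz2⟩, rfl⟩, hne⟩
      refine ⟨⟨(hCz z).2 hz1, hne⟩, z, (hball z).2 (lt_of_le_of_ne hz2 fun h1 => hne ?_), rfl⟩
      -- a point of the circline on the unit circle is one of the two vertices
      rw [circZ, h1, sub_self, mul_zero, zero_add, mul_eq_zero, or_iff_right (by positivity),
        sub_eq_zero] at hz1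
      rw [Complex.normSq_apply, hz1] at h1
      have h2 : z.im ^ 2 = (2 * h / (1 + h ^ 2)) ^ 2 := by linarith
      rcases sq_eq_sq_iff_eq_or_eq_neg.1 h2 with h3 | h3
      · left
        rw [pointA, one_sub_two_div_vertA]
        exact congrArg _ (Complex.ext hz1 h3)
      · right
        rw [Set.mem_singleton_iff, pointA, one_sub_two_div_vertA, neg_sq, mul_neg, neg_div]
        exact congrArg _ (Complex.ext hz1 h3)
  · refine ⟨chart (vertQ h t : OnePoint ℂ), ⟨_, ⟨_, vertQ_mem_arc0 H, rfl⟩, rfl⟩, ?_⟩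
    rw [← chart_vertA, ← chart_vertA]
    have ht := H.two_lt
    rintro (h0 | h0) <;>
    · have := congrArg Complex.re (OnePoint.coe_injective (chart.injective h0))
      simp only [vertQ, vertA] at this
      linarith

theorem isArc_edge (h : ℝ) : IsArc (pointA h) pointO (edge h) := by
  rw [edge_eq_segment]
  refine isArc_segment fun h0 => pointO_ne_pointA h ?_
  rw [pointA, h0, pointO]

theorem edge_inter_edge {h : ℝ} (hh : h ≠ 0) : edge h ∩ edge (-h) = {pointO} := by
  rw [edge, edge, ← Set.image_inter chart.injective, ← chart_infty', ← Set.image_singleton]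
  congr 1
  ext w
  constructor
  · rintro ⟨rfl | ⟨u, hu, rfl⟩, h2⟩
    · rfl
    · rcases h2 with h2 | ⟨v, hv, h2⟩
      · exact h2
      · obtain rfl := OnePoint.coe_injective h2
        have h3 := hu.2
        rw [hv.2] at h3
        have h4 : h * v.re = 0 := by linarith
        have h5 := (mul_eq_zero.1 h4).resolve_left hh
        have := hv.1
        linarith
  · rintro rfl
    exact ⟨Or.inl rfl, Or.inl rfl⟩

theorem edge_inter_edge0 {h t : ℝ} (H : FareyParam h t) : edge h ∩ edge0 h t = {pointA h} := by
  rw [edge, edge0, ← Set.image_inter chart.injective, Set.insert_inter_of_notMem,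
    ← Set.image_inter OnePoint.coe_injective, ray_inter_arc0 H, Set.image_singleton,
    Set.image_singleton, chart_vertA]
  exact OnePoint.infty_notMem_image_coe

/-- A line that contains both `s₊` and `s₋` would contain the vertices of a triangle. -/
theorem not_exists_circline_edge {h : ℝ} (hh : h ≠ 0) :
    ¬ ∃ C, IsCircline C ∧ edge h ⊆ C ∧ edge (-h) ⊆ C := by
  rintro ⟨C, hC, h1, h2⟩
  rw [edge_eq_segment] at h1 h2
  have hA : (1 - 2 / vertA h) ≠ 1 := fun h0 => pointO_ne_pointA h (by rw [pointA, h0, pointO])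
  obtain ⟨a, v, -, rfl⟩ := circline_of_segment hA hC h1
  have hmem : ∀ z : ℂ, (z : OnePoint ℂ) ∈ insert ∞
      ((fun z : ℂ => (z : OnePoint ℂ)) '' {z : ℂ | ∃ t : ℝ, z = a + t * v}) →
      ∃ t : ℝ, z = a + t * v := by
    rintro z (h0 | ⟨w, hw, h0⟩)
    · exact absurd h0 (OnePoint.coe_ne_infty z)
    · rwa [← OnePoint.coe_injective h0]
  obtain ⟨r, hr⟩ := hmem _ (h1 ⟨_, left_mem_segment ℝ _ _, rfl⟩)
  obtain ⟨s, hs⟩ := hmem _ (h1 ⟨_, right_mem_segment ℝ _ _, rfl⟩)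
  obtain ⟨q, hq⟩ := hmem _ (h2 ⟨_, left_mem_segment ℝ _ _, rfl⟩)
  rw [one_sub_two_div_vertA] at hr hq
  have hN : 0 < 1 + h ^ 2 := by positivity
  have r1 := congrArg Complex.re hr
  have r2 := congrArg Complex.im hr
  have s1 := congrArg Complex.re hs
  have s2 := congrArg Complex.im hs
  have q1 := congrArg Complex.re hq
  have q2 := congrArg Complex.im hq
  simp at r1 r2 s1 s2 q1 q2
  have hc : 1 - (h ^ 2 - 1) / (1 + h ^ 2) ≠ 0 := by
    have : 1 - (h ^ 2 - 1) / (1 + h ^ 2) = 2 / (1 + h ^ 2) := by field_simp; ring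
    rw [this]; positivity
  have hsn : 2 * h / (1 + h ^ 2) ≠ 0 := div_ne_zero (mul_ne_zero two_ne_zero hh) hN.ne'
  have hneg : -(2 * h) / (1 + h ^ 2) = -(2 * h / (1 + h ^ 2)) := neg_div _ _
  rw [hneg] at q2
  generalize (h ^ 2 - 1) / (1 + h ^ 2) = c at *
  generalize 2 * h / (1 + h ^ 2) = d at *
  have e1 : 1 - c = (s - r) * v.re := by linarith
  have e2 : -d = (s - r) * v.im := by linarith
  have e3 : 1 - c = (s - q) * v.re := by linarith
  have e4 : d = (s - q) * v.im := by linarith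
  have : (1 - c) * d = -((1 - c) * d) := by
    calc (1 - c) * d = ((s - r) * v.re) * ((s - q) * v.im) := by rw [← e1, ← e4]
      _ = ((s - q) * v.re) * ((s - r) * v.im) := by ring
      _ = -((1 - c) * d) := by rw [← e3, ← e2]; ring
  exact mul_ne_zero hc hsn (by linarith)

/-- The lines of `s₊` and `s₋` meet again at `∞`. -/
theorem lineInfty_inter {h : ℝ} (hh : h ≠ 0) :
    lineInfty (1 - 2 / vertA h) 1 ∩ lineInfty (1 - 2 / vertA (-h)) 1 = {pointO, ∞} := by
  have hN : 0 < 1 + h ^ 2 := by positivity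
  ext x
  constructor
  · rintro ⟨rfl | ⟨z, ⟨r, hr⟩, rfl⟩, h2⟩
    · exact Or.inr rfl
    · rcases h2 with h2 | ⟨w, ⟨s, hs⟩, h2⟩
      · exact absurd h2 (OnePoint.coe_ne_infty z)
      · obtain rfl := OnePoint.coe_injective h2
        left
        rw [one_sub_two_div_vertA] at hr hs
        have r1 := congrArg Complex.re hr
        have r2 := congrArg Complex.im hr
        have s1 := congrArg Complex.re hs
        have s2 := congrArg Complex.im hs
        simp at r1 r2 s1 s2
        have hc : 1 - (h ^ 2 - 1) / (1 + h ^ 2) ≠ 0 := by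
          have : 1 - (h ^ 2 - 1) / (1 + h ^ 2) = 2 / (1 + h ^ 2) := by field_simp; ring
          rw [this]; positivity
        have hsn : 2 * h / (1 + h ^ 2) ≠ 0 := div_ne_zero (mul_ne_zero two_ne_zero hh) hN.ne'
        have hneg : -(2 * h) / (1 + h ^ 2) = -(2 * h / (1 + h ^ 2)) := neg_div _ _
        rw [hneg] at s2
        generalize (h ^ 2 - 1) / (1 + h ^ 2) = c at *
        generalize 2 * h / (1 + h ^ 2) = d at *
        have hrs : (r - s) * (1 - c) = 0 := by linarith
        have hrs := (mul_eq_zero.1 hrs).resolve_right hc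
        obtain rfl : r = s := by linarith
        have hr1 : (1 - r) * d = 0 := by linarith
        have hr1 := (mul_eq_zero.1 hr1).resolve_right hsn
        obtain rfl : r = 1 := by linarith
        refine congrArg _ (Complex.ext ?_ ?_)
        · rw [r1]; simp
        · rw [r2]; simp
  · rintro (rfl | rfl)
    · exact ⟨Or.inr ⟨1, ⟨1, by simp⟩, rfl⟩, Or.inr ⟨1, ⟨1, by simp⟩, rfl⟩⟩
    · exact ⟨Or.inl rfl, Or.inl rfl⟩

/-! ### The maps of the bryophyllum and the Farey conditions -/

section Maps

variable {h t : ℝ} {T : OnePoint ℂ → OnePoint ℂ}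

theorem apply_chart (hT : T ∘ chart = chart ∘ sphU h t) (w : OnePoint ℂ) :
    T (chart w) = chart (sphU h t w) := congrFun hT w

theorem isMoebiusMap_of_chart (H : FareyParam h t) (hT : T ∘ chart = chart ∘ sphU h t) :
    IsMoebiusMap T := by
  refine ⟨glMk 1 (-2) 1 0 (by norm_num) * glMk _ _ _ _ (sphU_det H) *
    (glMk 1 (-2) 1 0 (by norm_num))⁻¹, fun z => ?_⟩
  obtain ⟨w, rfl⟩ := chart.surjective z
  rw [apply_chart hT, mul_smul, mul_smul, chart_apply w, ← glMk_smul (by norm_num), inv_smul_smul,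
    glMk_smul, glMk_smul, chart_apply, sphU]

theorem map_pointA (hT : T ∘ chart = chart ∘ sphU h t) : T (pointA h) = pointO := by
  rw [← chart_vertA, apply_chart hT, sphU_vertA, chart_infty']

theorem map_pointA_neg (H : FareyParam h t) (hT : T ∘ chart = chart ∘ sphU h t) :
    T (pointA (-h)) = pointA h := by
  rw [← chart_vertA, apply_chart hT, sphU_coe (vertA_ne_neg H.ne).symm, mapU_vertA_neg H.ne,
    chart_vertA]

theorem map_pointO_mem (H : FareyParam h t) (hT : T ∘ chart = chart ∘ sphU h t) :
    T pointO ∈ edge0 h t := by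
  rw [← chart_infty', apply_chart hT, sphU_infty]
  exact ⟨_, ⟨_, vertQ_mem_arc0 H, rfl⟩, rfl⟩

theorem map_edge0 (H : FareyParam h t) (hT : T ∘ chart = chart ∘ sphU h t) :
    T '' edge0 h t = edge h := by
  rw [edge0, ← Set.image_comp, hT, Set.image_comp, sphU_image_arc0 H, edge]

theorem map_edge_neg (H : FareyParam h t) (hT : T ∘ chart = chart ∘ sphU h t) :
    ∃ C, IsCircline C ∧ edge0 h t ⊆ C ∧ T '' edge (-h) ⊆ C := by
  obtain ⟨C, hC, hCz, hCi⟩ := exists_circline h t H.ne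
  have key : ∀ u : ℂ, circF h t u = 0 → chart (u : OnePoint ℂ) ∈ C := by
    intro u hu
    by_cases hu0 : u = 0
    · subst hu0
      rw [chart_zero]
      exact hCi (by simpa [circF] using hu)
    · rw [chart_coe hu0, hCz, circZ_chart h t hu0, hu, mul_zero, zero_div]
  refine ⟨C, hC, ?_, ?_⟩
  · rintro _ ⟨_, ⟨u, hu, rfl⟩, rfl⟩
    exact key u hu.2
  · rintro _ ⟨_, ⟨w, rfl | ⟨u, hu, rfl⟩, rfl⟩, rfl⟩
    · rw [apply_chart hT, sphU_infty]
      exact key _ (circF_vertQ h t)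
    · have hua : u ≠ vertA h := by
        rintro rfl
        have := hu.2
        simp only [vertA] at this
        exact H.ne (by linarith)
      simp only [apply_chart hT, sphU_coe hua]
      apply key
      have := mapU_circF (t := t) hua
      rw [hu.2, neg_mul, add_neg_cancel, mul_zero] at this
      exact (mul_eq_zero.1 this).resolve_left (poleSq_pos hua).ne'

/-- The open triangle bounded by the edges. -/
def triangle (h t : ℝ) : Set (OnePoint ℂ) :=
  chart '' ((fun z : ℂ => (z : OnePoint ℂ)) '' openTri h t)

theorem triangle_neg (h t : ℝ) : triangle (-h) t = triangle h t := by
  rw [triangle, openTri_neg, triangle]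

theorem map_triangle (H : FareyParam h t) (hT : T ∘ chart = chart ∘ sphU h t) :
    T '' triangle h t ⊆ triangle h t := by
  rintro _ ⟨_, ⟨_, ⟨u, hu, rfl⟩, rfl⟩, rfl⟩
  simp only [apply_chart hT, sphU_coe (ne_of_mem_openTri hu)]
  exact ⟨_, ⟨_, mapU_mem_openTri H hu, rfl⟩, rfl⟩

theorem continuous_of_chart (H : FareyParam h t) (hT : T ∘ chart = chart ∘ sphU h t) :
    Continuous T := by
  rw [← chart.comp_continuous_iff', hT]
  exact chart.continuous.comp (sphU_continuous H)

theorem map_closure_triangle (H : FareyParam h t) (hT : T ∘ chart = chart ∘ sphU h t) :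
    T '' closure (triangle h t) ⊆ closure (triangle h t) :=
  (image_closure_subset_closure_image (continuous_of_chart H hT)).trans
    (closure_mono (map_triangle H hT))

theorem closure_triangle_subset (h t : ℝ) : closure (triangle h t) ⊆
    chart '' insert ∞ ((fun z : ℂ => (z : OnePoint ℂ)) '' closedTri h t) := by
  refine closure_minimal (Set.image_mono ?_) (chart.isClosedMap _ ?_)
  · exact (Set.image_mono (openTri_subset_closedTri h t)).trans (Set.subset_insert _ _)
  · rw [OnePoint.isClosed_iff_of_mem (Set.mem_insert _ _)]
    convert isClosed_closedTri h t using 1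
    ext z
    simp

theorem pointA_mem_closure (H : FareyParam h t) : pointA h ∈ closure (triangle h t) := by
  rw [← chart_vertA]
  have h1 : Continuous fun z : ℂ => chart (z : OnePoint ℂ) :=
    chart.continuous.comp OnePoint.continuous_coe
  have := image_closure_subset_closure_image h1 (s := openTri h t)
    ⟨_, vertA_mem_closure H, rfl⟩
  rwa [triangle, ← Set.image_comp]

/-- Away from the vertex `A₀`, the image of the closed triangle under `T₊` lies strictly on one
side of the real axis. -/
theorem map_closure_triangle_side (H : FareyParam h t) (hT : T ∘ chart = chart ∘ sphU h t)
    {x : OnePoint ℂ} (hx : x ∈ T '' closure (triangle h t)) :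
    x = pointO ∨ ∃ v : ℂ, 0 < h * v.im ∧ x = chart v := by
  obtain ⟨_, hy, rfl⟩ := hx
  obtain ⟨w, hw, rfl⟩ := closure_triangle_subset h t hy
  rw [apply_chart hT]
  rcases hw with rfl | ⟨u, hu, rfl⟩
  · right
    refine ⟨vertQ h t, ?_, by rw [sphU_infty]⟩
    have h1 : 0 < h ^ 2 := by have := H.ne; positivity
    have h2 := mul_pos h1 (sub_pos.2 H.two_lt)
    simp only [vertQ]
    linarith
  · by_cases hua : u = vertA h
    · subst hua
      left
      simp only [sphU_vertA, chart_infty']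
    · right
      exact ⟨mapU h t u, mapU_im_pos H hua hu, by simp only [sphU_coe hua]⟩

end Maps

/-- The Separation Condition. -/
theorem separation {h t : ℝ} (H : FareyParam h t) {Tp Tm : OnePoint ℂ → OnePoint ℂ}
    (hTp : Tp ∘ chart = chart ∘ sphU h t) (hTm : Tm ∘ chart = chart ∘ sphU (-h) t) :
    Tp '' closure (triangle h t) ∩ Tm '' closure (triangle h t) = {pointO} := by
  apply Set.Subset.antisymm
  · rintro x ⟨h1, h2⟩
    rw [← triangle_neg] at h2
    rcases map_closure_triangle_side H hTp h1 with h1 | ⟨v, hv, rfl⟩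
    · exact h1
    · rcases map_closure_triangle_side H.neg hTm h2 with h2 | ⟨w, hw, hvw⟩
      · exact h2
      · rw [← OnePoint.coe_injective (chart.injective hvw)] at hw
        linarith
  · rintro _ rfl
    refine ⟨⟨_, pointA_mem_closure H, map_pointA hTp⟩, ?_⟩
    rw [← triangle_neg]
    exact ⟨_, pointA_mem_closure H.neg, map_pointA hTm⟩

/-- The complement of the edges consists of the open triangle and of the complement of the closed
triangle. -/
theorem isComponentOf_edges {h t : ℝ} (H : FareyParam h t) (U : Set (OnePoint ℂ)) :
    IsComponentOf U (edge h ∪ edge (-h) ∪ edge0 h t)ᶜ ↔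
      U = triangle h t ∨
        U = chart '' ((fun z : ℂ => (z : OnePoint ℂ)) '' (closedTri h t)ᶜ) := by
  have hopen : ∀ s : Set ℂ, IsOpen s →
      IsOpen (chart '' ((fun z : ℂ => (z : OnePoint ℂ)) '' s)) := fun s hs =>
    chart.isOpenMap _ (OnePoint.isOpen_image_coe.2 hs)
  have hpre : ∀ s : Set ℂ, IsPreconnected s →
      IsPreconnected (chart '' ((fun z : ℂ => (z : OnePoint ℂ)) '' s)) := fun s hs =>
    (hs.image _ OnePoint.continuous_coe.continuousOn).image _ chart.continuous.continuousOn
  refine isComponentOf_iff ?_ ?_ (hopen _ (isOpen_openTri h t))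
    (hopen _ (isClosed_closedTri h t).isOpen_compl) (hpre _ (isPreconnected_openTri H))
    (hpre _ (isPreconnected_compl_closedTri H)) (((nonempty_openTri H).image _).image _) ?_
  · have h1 : edge h ∪ edge (-h) ∪ edge0 h t = chart '' insert ∞
        ((fun z : ℂ => (z : OnePoint ℂ)) '' (ray h ∪ ray (-h) ∪ arc0 h t)) := by
      simp only [edge, edge0, ← Set.image_union]
      congr 1
      ext w
      simp only [Set.mem_union, Set.mem_insert_iff, Set.image_union]
      tauto
    have h2 : (insert ∞ ((fun z : ℂ => (z : OnePoint ℂ)) '' (ray h ∪ ray (-h) ∪ arc0 h t)))ᶜ =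
        (fun z : ℂ => (z : OnePoint ℂ)) '' (ray h ∪ ray (-h) ∪ arc0 h t)ᶜ := by
      ext w
      induction w using OnePoint.rec with
      | infty => simp
      | coe w => simp
    have h3 : (ray h ∪ ray (-h) ∪ arc0 h t)ᶜ = openTri h t ∪ (closedTri h t)ᶜ := by
      rw [closedTri_eq H]
      have := Set.disjoint_left.1 (openTri_disjoint (h := h) (t := t))
      ext w
      have := @this w
      simp only [Set.mem_compl_iff, Set.mem_union] at *
      tauto
    rw [h1, ← Set.image_compl_eq chart.bijective, h2, h3, Set.image_union, Set.image_union,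
      triangle]
  · refine (Set.disjoint_image_iff chart.injective).2
      ((Set.disjoint_image_iff OnePoint.coe_injective).2 ?_)
    exact Set.disjoint_compl_right_iff_subset.2 (openTri_subset_closedTri h t)
  · refine ⟨_, _, ⟨0, fun h0 => ?_, rfl⟩, rfl⟩
    have := h0.1
    simp only [Complex.zero_re] at this
    linarith

theorem infty_notMem_triangle (h t : ℝ) : ∞ ∉ triangle h t := by
  rw [← chart_zero]
  rintro ⟨_, ⟨u, hu, rfl⟩, h0⟩
  rw [OnePoint.coe_injective (chart.injective h0)] at hu
  have := hu.1
  simp only [Complex.zero_re] at this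
  linarith

theorem infty_mem_outside (h t : ℝ) :
    ∞ ∈ chart '' ((fun z : ℂ => (z : OnePoint ℂ)) '' (closedTri h t)ᶜ) := by
  refine ⟨_, ⟨0, fun h0 => ?_, rfl⟩, chart_zero⟩
  have := h0.1
  simp only [Complex.zero_re] at this
  linarith

theorem isFarey_of_chart {h t : ℝ} (H : FareyParam h t) {B : BryophyllumData}
    (hA0 : B.A0 = pointO) (hAp : B.Ap = pointA h) (hAm : B.Am = pointA (-h))
    (hsp : B.sp = edge h) (hsm : B.sm = edge (-h)) (hs0 : B.s0 = edge0 h t)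
    (hTp : B.Tp ∘ chart = chart ∘ sphU h t) (hTm : B.Tm ∘ chart = chart ∘ sphU (-h) t) :
    B.IsFarey := by
  obtain ⟨A0, Ap, Am, sp, sm, s0, Tp, Tm⟩ := B
  simp only at hA0 hAp hAm hsp hsm hs0 hTp hTm
  subst hA0 hAp hAm hsp hsm hs0
  have hsm0 : edge (-h) ∩ edge0 h t = {pointA (-h)} := by
    rw [← edge0_neg]; exact edge_inter_edge0 H.neg
  refine ⟨?_, ⟨edge_inter_edge H.ne, edge_inter_edge0 H, hsm0⟩, triangle h t,
    ⟨∞, ⟨OnePoint.infty_ne_coe _, lineInfty (1 - 2 / vertA h) 1, lineInfty (1 - 2 / vertA (-h)) 1,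
      ?_, ?_, ?_, ?_, lineInfty_inter H.ne⟩, ?_⟩, ⟨map_triangle H hTp, ?_⟩,
    ⟨map_closure_triangle H hTp, ?_⟩, separation H hTp hTm⟩
  · exact
      { ne_0p := pointO_ne_pointA h
        ne_0m := pointO_ne_pointA (-h)
        ne_pm := pointA_ne_neg H.ne
        arc_0 := isArc_edge0 H
        arc_p := isArc_edge h
        arc_m := isArc_edge (-h)
        circlines_ne := not_exists_circline_edge H.ne
        inter_pm := edge_inter_edge H.ne
        conf_p := isMoebiusMap_of_chart H hTp
        conf_m := isMoebiusMap_of_chart H.neg hTm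
        Tp_Ap := map_pointA hTp
        Tp_Am := map_pointA_neg H hTp
        Tp_s0 := map_edge0 H hTp
        Tm_Am := map_pointA hTm
        Tm_Ap := by simpa using map_pointA_neg H.neg hTm
        Tm_s0 := by simpa [edge0_neg] using map_edge0 H.neg hTm
        Tp_A0 := map_pointO_mem H hTp
        Tm_A0 := by simpa [edge0_neg] using map_pointO_mem H.neg hTm
        Tp_sm := map_edge_neg H hTp
        Tm_sp := by simpa [edge0_neg] using map_edge_neg H.neg hTm }
  · exact isCircline_lineInfty fun h0 => pointO_ne_pointA h (by rw [pointA, h0, pointO])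
  · exact isCircline_lineInfty fun h0 => pointO_ne_pointA (-h) (by rw [pointA, h0, pointO])
  · exact (edge_eq_segment h).trans_subset (segment_subset_lineInfty _ _)
  · exact (edge_eq_segment (-h)).trans_subset (segment_subset_lineInfty _ _)
  · intro U
    rw [isComponentOf_edges H]
    constructor
    · rintro ⟨rfl | rfl, h2⟩
      · rfl
      · exact absurd (infty_mem_outside h t) h2
    · rintro rfl
      exact ⟨Or.inl rfl, infty_notMem_triangle h t⟩
  · have := map_triangle H.neg hTm
    rwa [triangle_neg] at this
  · have := map_closure_triangle H.neg hTm
    rwa [triangle_neg] at this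

end

theorem mainTheorem2 (φ ψ : ℝ)
    (hφ : φ ∈ Set.Ioo 0 Real.pi) (hψ : ψ ∈ Set.Icc 0 Real.pi) (hne : φ + ψ ≠ Real.pi)
    (h1 : 0 ≤ Real.sin ψ + 2 * Real.sin (ψ - φ / 2) * Real.cos (φ / 2))
    (h2 : 0 ≤ Real.sin ψ * Real.cos φ - 2 * Real.sin (ψ - φ / 2) * Real.cos (φ / 2))
    (h3 : φ + 2 * ψ < Real.pi) :
    (canonicalBryophyllum φ ψ).IsFarey := by
  obtain ⟨h, t, H, hA, hA', hQ, hQ', hp⟩ := exists_fareyParam hφ hψ h1 h2 h3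
  refine isFarey_of_chart H rfl (congrArg _ hA) (congrArg _ hA') ?_ ?_ ?_ ?_ ?_
  · rw [edge_eq_segment, ← hA]; rfl
  · rw [edge_eq_segment, ← hA']; rfl
  · rw [edge0, arc0_image, ← canonicalS0_eq H hA hA' hQ hp]; rfl
  · exact canonicalT_chart H (Or.inl rfl) (by rwa [one_mul]) (by rwa [one_mul]) (by rwa [one_mul])
  · exact canonicalT_chart H.neg (Or.inr rfl) (by rwa [neg_one_mul])
      (by rwa [neg_one_mul, neg_neg, neg_neg]) (by rwa [neg_one_mul])
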